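/- Let $a>b>0$ and $\alpha>-1$ be real, put $c=\sqrt{a^2-b^2}$, and let $$E=\{z\in\mathbb{C}: h(z)<1\},\qquad h(z)=\frac{(\operatorname{Re} z)^2}{a^2}+\frac{(\operatorname{Im} z)^2}{b^2},\qquad dA_\alpha(z)=(1+\alpha)\,(1-h(z))^{\alpha}\,\frac{dx\,dy}{\pi ab}\quad(z=x+iy\in E).$$ Let $A^2_\alpha(E)$ be the weighted Bergman space, i.e. the space of all holomorphic functions on $E$ that lie in $L^2(E,dA_\alpha)$, with the inner product $\langle f,g\rangle_\alpha=\int_E f\,\overline{g}\,dA_\alpha$. For $n=0,1,2,\dots$ let $$C_n^{(1+\alpha)}(x)=\sum_{k=0}^{\lfloor n/2\rfloor}\frac{(-1)^k\,\Gamma(1+\alpha+n-k)}{\Gamma(1+\alpha)\,k!\,(n-2k)!}\,(2x)^{n-2k}$$ be the Gegenbauer polynomials and let $$h_n=\frac{1+\alpha}{1+\alpha+n}\,C_n^{(1+\alpha)}\!\left(\frac{a^2+b^2}{a^2-b^2}\right).$$ Then $h_n>0$ for every $n\ge 0$, and the polynomials $$p_n^{(\alpha)}(z)=\frac{1}{\sqrt{h_n}}\,C_n^{(1+\alpha)}\!\left(\frac{z}{c}\right),\qquad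 n=0,1,2,\dots,$$ form an orthonormal basis of the Hilbert space $A^2_\alpha(E)$. -/

import Mathlib

open MeasureTheory Polynomial

noncomputable section

/-- The standard Gegenbauer (ultraspherical) polynomial
`C_n^{(lam)}(X) = ∑_{k ≤ n/2} (-1)^k (lam)_{n-k} / (k! (n-2k)!) (2X)^{n-2k}`, where
`(lam)_m = lam (lam+1) ⋯ (lam+m-1)` is the rising factorial, equal to `Γ(lam+m)/Γ(lam)` for
`lam > 0`. -/
def gegenbauer (lam : ℝ) (n : ℕ) : ℝ[X] :=
  ∑ k ∈ Finset.range (n / 2 + 1),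
    C ((-1) ^ k * (ascPochhammer ℝ (n - k)).eval lam /
        ((k.factorial : ℝ) * ((n - 2 * k).factorial : ℝ))) * (2 * X) ^ (n - 2 * k)

/-- The quadratic form `h(z) = (Re z)² / a² + (Im z)² / b²`. -/
def ellipseForm (a b : ℝ) (z : ℂ) : ℝ := z.re ^ 2 / a ^ 2 + z.im ^ 2 / b ^ 2

/-- The interior of the ellipse with half-axes `a` and `b`. -/
def ellipse (a b : ℝ) : Set ℂ := {z | ellipseForm a b z < 1}

/-- The measure `dA_α(z) = (1+α) (1-h(z))^α dx dy / (π a b)` on the ellipse, as a measure on `ℂ`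
that vanishes off the ellipse. -/
def ellipseMeasure (a b α : ℝ) : Measure ℂ :=
  ((volume : Measure ℂ).restrict (ellipse a b)).withDensity fun z =>
    ENNReal.ofReal ((1 + α) * (1 - ellipseForm a b z) ^ α / (Real.pi * a * b))

/-- The weighted Bergman space `A²_α(E)`: the classes in `L²(E, dA_α)` that have a representative
which is holomorphic on the ellipse `E`. It carries the norm and the inner product of `L²`. -/
def bergmanSpace (a b α : ℝ) : Submodule ℂ (Lp ℂ 2 (ellipseMeasure a b α)) where
  carrier := {f | ∃ g : ℂ → ℂ, DifferentiableOn ℂ g (ellipse a b) ∧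
    (f : ℂ → ℂ) =ᵐ[ellipseMeasure a b α] g}
  zero_mem' := ⟨0, differentiableOn_const 0, Lp.coeFn_zero ℂ 2 _⟩
  add_mem' := by
    rintro f₁ f₂ ⟨g₁, hd₁, he₁⟩ ⟨g₂, hd₂, he₂⟩
    exact ⟨g₁ + g₂, hd₁.add hd₂, (Lp.coeFn_add f₁ f₂).trans (he₁.add he₂)⟩
  smul_mem' := by
    rintro r f ⟨g, hd, he⟩
    exact ⟨r • g, hd.const_smul r, (Lp.coeFn_smul r f).trans (he.const_smul r)⟩

/-- `h_n = (1+α)/(1+α+n) · C_n^{(1+α)}((a²+b²)/(a²-b²))`. -/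
def gegenbauerNormSq (a b α : ℝ) (n : ℕ) : ℝ :=
  (1 + α) / (1 + α + n) * (gegenbauer (1 + α) n).eval ((a ^ 2 + b ^ 2) / (a ^ 2 - b ^ 2))

/-- `p_n^{(α)}(z) = C_n^{(1+α)}(z/c) / √h_n`, where `c = √(a²-b²)`. -/
def normalizedGegenbauer (a b α : ℝ) (n : ℕ) (z : ℂ) : ℂ :=
  aeval (z / (Real.sqrt (a ^ 2 - b ^ 2) : ℂ)) (gegenbauer (1 + α) n) /
    (Real.sqrt (gegenbauerNormSq a b α n) : ℂ)

end

/-!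
Write `u = x / a + i y / b`, which maps the ellipse onto the unit disk, `t = 1 - h = 1 - u * conj u`,
`lam = 1 + α`, `c = √(a² - b²)` and `r = (a + b) / c`. Then `2 z / c = r u + r⁻¹ conj u`. Everything
is expressed by the moments `m(i, j) = ∫ f u ^ i (conj u) ^ j dA_α`.

If a first order operator `D` with constant coefficients annihilates `f`, integration by parts shows
that `f` is orthogonal to `t D g + lam g D t` for every polynomial `g` in `u` and `conj u`
(`integral_mul_weighted_adjoint_eq_zero`). A cutoff near the boundary is harmless for every
integrable `f`, since the factor `t ^ lam` gains a whole power of `t` over the weight `t ^ α`. Two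
cases matter. For `f = 1` the operator is arbitrary, and the moments of the measure follow
(`ellipseMoment_one`). For holomorphic `f` the Cauchy–Riemann operator gives
`(i + lam) m(i, j+1) - r² (j + lam) m(i+1, j) = i m(i-1, j) - r² j m(i, j-1)`
(`ellipseMoment_recurrence`). By induction, if `m(0, k) = 0` for all `k < n`, then all moments of
degree less than `n` vanish and those of degree `n` are explicit positive multiples of `m(0, n)`
(`moment_of_recurrence`). Therefore the pairing of such an `f` with `C_n(z / c)` is a positive multiple
of `m(0, n)` (`integral_mul_conj_ellipseGegenbauer`); the factor involves `C_n` at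
`(r² + r⁻²) / 2 = (a² + b²) / (a² - b²)`, a sum of positive terms by the trigonometric form of `C_n`.

For `f = C_n(z / c)` the moments `m(0, k)` with `k < n` vanish, being finite differences of too high an
order, and `m(0, n)` is a single term (`ellipseMoment_ellipseGegenbauer`). This gives orthogonality
and the norm. Conversely, if `f` in the Bergman space is orthogonal to every `C_n(z / c)`, then `m(0, n)`
vanishes for all `n` by induction, hence so do all moments, and `f = 0` by the Stone–Weierstrass theorem
(`ae_eq_zero_of_ellipseMoment_eq_zero`). The Bergman space is complete since point evaluations are
locally uniformly bounded (`isClosed_bergmanSpace`).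
-/

/-! ### Gegenbauer polynomials and finite sums -/

section
open Finset

/-- Reindexing of a double sum by `(s + k, t + k)`: terms of degree `n - 2k` in two variables are
collected according to the term of degree `n` that results from multiplication by the `k`-th power
of the product of the variables. -/
lemma sum_range_sum_antidiagonal_sub_two_mul {M : Type*} [AddCommMonoid M] (n : ℕ)
    (g : ℕ → ℕ → ℕ → M) :
    ∑ k ∈ range (n / 2 + 1), ∑ p ∈ antidiagonal (n - 2 * k), g k p.1 p.2 =
      ∑ p ∈ antidiagonal n, ∑ k ∈ range (min p.1 p.2 + 1), g k (p.1 - k) (p.2 - k) := by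
  rw [Finset.sum_sigma', Finset.sum_sigma']
  refine Finset.sum_bij' (fun x _ => ⟨(x.2.1 + x.1, x.2.2 + x.1), x.1⟩)
    (fun x _ => ⟨x.2, (x.1.1 - x.2, x.1.2 - x.2)⟩) ?_ ?_ ?_ ?_ ?_
  · rintro ⟨k, s, t⟩ h
    simp only [mem_sigma, mem_range, HasAntidiagonal.mem_antidiagonal] at h ⊢
    omega
  · rintro ⟨⟨s, t⟩, k⟩ h
    simp only [mem_sigma, mem_range, HasAntidiagonal.mem_antidiagonal] at h ⊢
    omega
  · rintro ⟨k, s, t⟩ h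
    simp
  · rintro ⟨⟨s, t⟩, k⟩ h
    simp only [mem_sigma, mem_range, HasAntidiagonal.mem_antidiagonal] at h
    simp only [Sigma.mk.injEq, Prod.mk.injEq, heq_eq_eq, and_true]
    omega
  · rintro ⟨k, s, t⟩ h
    simp

/-- Expansion of `C_n((v + w) / 2)` in monomials. The argument `x` is given by `2 * x = v + w`, so that
no division in `A` is needed. -/
lemma aeval_gegenbauer {A : Type*} [CommRing A] [Algebra ℝ A] (lam : ℝ) (n : ℕ) {x v w : A}
    (hx : 2 * x = v + w) :
    aeval x (gegenbauer lam n) = ∑ k ∈ range (n / 2 + 1), ∑ p ∈ antidiagonal (n - 2 * k),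
      ((-1) ^ k * (ascPochhammer ℝ (n - k)).eval lam /
        (k.factorial * p.1.factorial * p.2.factorial) : ℝ) • (v ^ p.1 * w ^ p.2) := by
  rw [gegenbauer, map_sum]
  refine sum_congr rfl fun k _ => ?_
  have h2 : aeval x (2 * X : ℝ[X]) = v + w := by
    rw [← hx, map_mul, aeval_X, map_ofNat]
  rw [map_mul, map_pow, h2, aeval_C, (Commute.all v w).add_pow', Finset.mul_sum]
  refine sum_congr rfl fun p hp => ?_
  rw [HasAntidiagonal.mem_antidiagonal] at hp
  rw [← hp, ← Nat.cast_smul_eq_nsmul ℝ, ← Algebra.smul_def, smul_smul, Nat.cast_add_choose]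
  congr 1
  have := (Nat.cast_ne_zero (R := ℝ)).2 (p.1 + p.2).factorial_ne_zero
  field_simp

/-- The Chu–Vandermonde identity for rising factorials. -/
lemma sum_antidiagonal_choose_mul_ascPochhammer (x y : ℝ) (n : ℕ) :
    ∑ p ∈ antidiagonal n, (n.choose p.1 : ℝ) *
      ((ascPochhammer ℝ p.1).eval x * (ascPochhammer ℝ p.2).eval y) =
      (ascPochhammer ℝ n).eval (x + y) := by
  induction n with
  | zero => simp
  | succ n ih =>
    rw [Finset.sum_antidiagonal_choose_succ_mul
      (fun i j => (ascPochhammer ℝ i).eval x * (ascPochhammer ℝ j).eval y) n,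
      ascPochhammer_succ_eval, ← ih, Finset.sum_mul, ← sum_add_distrib]
    refine sum_congr rfl fun p hp => ?_
    rw [HasAntidiagonal.mem_antidiagonal] at hp
    simp only [ascPochhammer_succ_eval, ← hp]
    rw [Nat.choose_symm_add]
    push_cast; ring

lemma ascPochhammer_eval_add (x : ℝ) (m n : ℕ) :
    (ascPochhammer ℝ (m + n)).eval x =
      (ascPochhammer ℝ m).eval x * (ascPochhammer ℝ n).eval (x + m) := by
  rw [← ascPochhammer_mul]; simp

/-- The coefficient of `v ^ s * w ^ t` in `C_{s+t}((v + w) / 2)` when `v * w = 1`; this is the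
Chu–Vandermonde identity with arguments `-t` and `lam + t`. -/
lemma sum_gegenbauer_coeff (lam : ℝ) (s t : ℕ) :
    ∑ k ∈ range (min s t + 1), (-1) ^ k * (ascPochhammer ℝ (s + t - k)).eval lam /
        (k.factorial * (s - k).factorial * (t - k).factorial) =
      (ascPochhammer ℝ s).eval lam * (ascPochhammer ℝ t).eval lam /
        (s.factorial * t.factorial) := by
  have hV := sum_antidiagonal_choose_mul_ascPochhammer (-(t : ℝ)) (lam + t) s
  rw [Finset.Nat.sum_antidiagonal_eq_sum_range_succ_mk] at hV
  have hsub : range (min s t + 1) ⊆ range (s + 1) := by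
    intro k; simp only [mem_range]; omega
  rw [← Finset.sum_subset hsub] at hV
  · rw [neg_add_cancel_comm_assoc] at hV
    rw [← hV, Finset.sum_mul, Finset.sum_div]
    refine sum_congr rfl fun k hk => ?_
    simp only [mem_range] at hk
    obtain ⟨i, rfl⟩ : ∃ i, s = k + i := ⟨s - k, by omega⟩
    obtain ⟨j, rfl⟩ : ∃ j, t = k + j := ⟨t - k, by omega⟩
    rw [ascPochhammer_eval_neg_eq_descPochhammer, descPochhammer_eval_eq_descFactorial,
      Nat.cast_add_choose, show k + i + (k + j) - k = k + j + i by omega, ascPochhammer_eval_add]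
    have h1 := Nat.factorial_mul_descFactorial (n := k + j) (k := k) (by omega)
    simp only [add_tsub_cancel_left] at h1 ⊢
    rw [← h1]
    have h3 := (Nat.cast_ne_zero (R := ℝ)).2 (k + i).factorial_ne_zero
    have h4 := (Nat.cast_ne_zero (R := ℝ)).2 ((Nat.pos_of_mul_pos_left (h1 ▸ (k+j).factorial_pos)).ne')
    push_cast at h4 ⊢
    field_simp
  · intro k hk hk'
    simp only [mem_range] at hk hk'
    rw [ascPochhammer_eval_neg_coe_nat_of_lt (by omega)]
    simp

/-- The trigonometric form of the Gegenbauer polynomial, with `v`, `w` in the role of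
`exp (iθ)`, `exp (-iθ)`. For `lam > 0` all its coefficients are positive. -/
lemma aeval_gegenbauer_of_mul_eq_one {A : Type*} [CommRing A] [Algebra ℝ A] (lam : ℝ) (n : ℕ)
    {x v w : A} (hx : 2 * x = v + w) (hvw : v * w = 1) :
    aeval x (gegenbauer lam n) = ∑ p ∈ antidiagonal n,
      ((ascPochhammer ℝ p.1).eval lam * (ascPochhammer ℝ p.2).eval lam /
        (p.1.factorial * p.2.factorial) : ℝ) • (v ^ p.1 * w ^ p.2) := by
  rw [aeval_gegenbauer lam n hx, sum_range_sum_antidiagonal_sub_two_mul n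
    fun k s t => ((-1) ^ k * (ascPochhammer ℝ (n - k)).eval lam /
        (k.factorial * s.factorial * t.factorial) : ℝ) • (v ^ s * w ^ t)]
  refine sum_congr rfl fun p hp => ?_
  rw [HasAntidiagonal.mem_antidiagonal] at hp
  rw [← sum_gegenbauer_coeff, sum_smul, hp]
  refine sum_congr rfl fun k hk => ?_
  simp only [mem_range] at hk
  congr 1
  obtain ⟨i, hi⟩ : ∃ i, p.1 = k + i := ⟨p.1 - k, by omega⟩
  obtain ⟨j, hj⟩ : ∃ j, p.2 = k + j := ⟨p.2 - k, by omega⟩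
  rw [hi, hj, pow_add, pow_add]
  simp only [add_tsub_cancel_left]
  calc v ^ i * w ^ j = (v * w) ^ k * (v ^ i * w ^ j) := by rw [hvw, one_pow, one_mul]
    _ = _ := by ring

/-- The quotient of rising factorials is `lam` times a polynomial of degree `t` in `l`, so its
`(t + 1)`-st finite difference vanishes. -/
lemma sum_choose_mul_ascPochhammer_div (lam : ℝ) (hlam : 0 < lam) (k t : ℕ) :
    ∑ l ∈ range (t + 1 + 1), (-1) ^ l * ((t + 1).choose l : ℝ) *
      ((ascPochhammer ℝ (k + (t + 1) + (t + 1) - l)).eval lam /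
        (ascPochhammer ℝ (k + (t + 1) - l)).eval (lam + 1)) = 0 := by
  have h := fwdDiff_iter_eq_zero_of_degree_lt (R := ℝ) (n := t + 1)
    (P := (ascPochhammer ℝ t)) (by
      rw [ascPochhammer_natDegree]
      exact Nat.lt_succ_self t)
  have h1 := congrFun h (lam + 1 + k)
  rw [fwdDiff_iter_eq_sum_shift] at h1
  rw [← Finset.sum_range_reflect] at h1
  rw [← mul_zero lam, ← (show (0 : ℝ → ℝ) (lam + 1 + k) = 0 from rfl), ← h1, Finset.mul_sum]
  refine sum_congr rfl fun l hl => ?_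
  simp only [mem_range] at hl
  obtain ⟨j, hj⟩ : ∃ j, t + 1 = l + j := ⟨t + 1 - l, by omega⟩
  rw [show t + 1 + 1 - 1 - l = j by omega, show t + 1 - j = l by omega,
    show (t + 1).choose j = (t + 1).choose l by rw [hj]; exact (Nat.choose_symm_add).symm,
    show k + (t + 1) + (t + 1) - l = 1 + ((k + j) + t) by omega,
    show k + (t + 1) - l = k + j by omega, ascPochhammer_eval_add lam 1,
    ascPochhammer_eval_add _ (k + j)]
  have := (ascPochhammer_pos (k + j) (lam + 1) (by linarith)).ne'
  simp only [ascPochhammer_one, eval_X, Nat.cast_one]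
  field_simp
  simp only [Nat.cast_add, nsmul_eq_mul, mul_one, zsmul_eq_mul]
  push_cast
  rw [← add_assoc]

/-- The moment `∫ u ^ i * conj u ^ j` over the unit disk for the probability measure with density
proportional to `(1 - |u|²) ^ (lam - 1)`. -/
noncomputable def diskMoment (lam : ℝ) (i j : ℕ) : ℝ :=
  if i = j then i.factorial / (ascPochhammer ℝ i).eval (lam + 1) else 0

/-- The integral of `C_n((r u + r⁻¹ conj u) / 2) * conj u ^ m` over the weighted disk, for `m ≤ n`,
written out as a sum of moments. It vanishes for `m < n`, which is the source of orthogonality. -/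
lemma sum_gegenbauer_coeff_mul_diskMoment {lam : ℝ} (hlam : 0 < lam) {r : ℝ} (hr : 0 < r)
    {m n : ℕ} (hmn : m ≤ n) :
    ∑ k ∈ range (n / 2 + 1), ∑ p ∈ antidiagonal (n - 2 * k),
      (-1) ^ k * (ascPochhammer ℝ (n - k)).eval lam /
        (k.factorial * p.1.factorial * p.2.factorial) *
          (r ^ p.1 * r⁻¹ ^ p.2 * diskMoment lam p.1 (p.2 + m)) =
      if m = n then r ^ n * (lam / (lam + n)) else 0 := by
  -- After reindexing, only the pair with `p.1 = p.2 + m` carries nonzero moments.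
  rw [sum_range_sum_antidiagonal_sub_two_mul n fun k s t =>
    (-1) ^ k * (ascPochhammer ℝ (n - k)).eval lam / (k.factorial * s.factorial * t.factorial) *
      (r ^ s * r⁻¹ ^ t * diskMoment lam s (t + m))]
  have hzero : ∀ p ∈ antidiagonal n, p.1 ≠ p.2 + m →
      ∑ k ∈ range (min p.1 p.2 + 1), (-1) ^ k * (ascPochhammer ℝ (n - k)).eval lam /
        (k.factorial * (p.1 - k).factorial * (p.2 - k).factorial) *
      (r ^ (p.1 - k) * r⁻¹ ^ (p.2 - k) * diskMoment lam (p.1 - k) (p.2 - k + m)) = 0 := by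
    intro p hp hne
    refine sum_eq_zero fun k hk => ?_
    simp only [mem_range] at hk
    rw [diskMoment, if_neg (by omega)]
    simp
  split_ifs with hm
  · subst hm
    rw [Finset.sum_eq_single (m, 0)]
    · have h1 : (ascPochhammer ℝ m).eval lam * (lam + m) =
          lam * (ascPochhammer ℝ m).eval (lam + 1) := by
        rw [← ascPochhammer_succ_eval, add_comm m 1, ascPochhammer_eval_add]
        simp
      have h2 := (ascPochhammer_pos m (lam + 1) (by linarith)).ne'
      have h3 := (Nat.cast_ne_zero (R := ℝ)).2 m.factorial_ne_zero
      have h4 : lam + m ≠ 0 := by positivity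
      simp [diskMoment]
      field_simp
      linarith
    · rintro ⟨s, t⟩ hp hne
      apply hzero _ hp
      rw [HasAntidiagonal.mem_antidiagonal] at hp
      rintro h
      apply hne
      simp only at h hp
      ext <;> simp <;> omega
    · simp
  · refine sum_eq_zero fun p hp => ?_
    by_cases h : p.1 = p.2 + m
    · obtain ⟨s, t⟩ := p
      rw [HasAntidiagonal.mem_antidiagonal] at hp
      simp only at h hp ⊢
      subst h
      obtain ⟨τ, rfl⟩ : ∃ τ, t = τ + 1 := ⟨t - 1, by omega⟩
      have := sum_choose_mul_ascPochhammer_div lam hlam m τ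
      rw [min_eq_right (by omega)]
      rw [← mul_zero (r ^ m / (τ + 1).factorial), ← this, Finset.mul_sum]
      refine sum_congr rfl fun k hk => ?_
      simp only [mem_range] at hk
      obtain ⟨j, hj⟩ : ∃ j, τ + 1 = k + j := ⟨τ + 1 - k, by omega⟩
      rw [hj, show k + j + m - k = m + j by omega, show k + j - k = j by omega,
        show m + (k + j) + (k + j) - k = n - k by omega, show m + (k + j) - k = m + j by omega,
        diskMoment, if_pos (by omega), Nat.cast_add_choose, pow_add]
      have h3 := (Nat.cast_ne_zero (R := ℝ)).2 (k + j).factorial_ne_zero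
      have h4 := (Nat.cast_ne_zero (R := ℝ)).2 (m + j).factorial_ne_zero
      have h5 := (ascPochhammer_pos (m + j) (lam + 1) (by linarith)).ne'
      field_simp
      rw [mul_assoc, ← mul_pow, mul_one_div_cancel hr.ne', one_pow, mul_one]
    · exact hzero p hp h

/-- The recurrence is the one satisfied by the moments `m i j = ∫ f u ^ i conj u ^ j` of a holomorphic
function. It determines all moments of degree at most `n` from the antiholomorphic ones `m 0 k`, as
it moves one factor `conj u` to `u` modulo moments of lower degree. For `i = 0` or `j = 0` the
truncated index `i - 1` or `j - 1` comes with the coefficient `0`. -/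
lemma moment_of_recurrence {lam : ℝ} (hlam : 0 < lam) {r : ℝ} (hr : 0 < r) {m : ℕ → ℕ → ℂ}
    (hrec : ∀ i j : ℕ, ((i + lam : ℝ) : ℂ) * m i (j + 1) - ((r ^ 2 * (j + lam) : ℝ) : ℂ) * m (i + 1) j =
      i * m (i - 1) j - ((r ^ 2 * j : ℝ) : ℂ) * m i (j - 1))
    {n : ℕ} (h0 : ∀ k < n, m 0 k = 0) (i j : ℕ) :
    (i + j < n → m i j = 0) ∧
    (i + j = n → m i j = ((r⁻¹ ^ (2 * i) * (ascPochhammer ℝ i).eval lam *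
      (ascPochhammer ℝ j).eval lam / (ascPochhammer ℝ n).eval lam : ℝ) : ℂ) * m 0 n) := by
  induction i using Nat.strong_induction_on generalizing j with
  | _ i ih =>
    cases i with
    | zero =>
      refine ⟨fun h => h0 j (by omega), fun h => ?_⟩
      obtain rfl : j = n := by omega
      have := (ascPochhammer_pos j lam hlam).ne'
      simp [this]
    | succ i =>
      have hj : (0 : ℝ) < r ^ 2 * (j + lam) := by positivity
      have hj' : ((r ^ 2 * (j + lam) : ℝ) : ℂ) ≠ 0 := by exact_mod_cast hj.ne'
      have hlow : i + 1 + j ≤ n → i * m (i - 1) j - ((r ^ 2 * j : ℝ) : ℂ) * m i (j - 1) = 0 := by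
        intro hn
        have h1 : (i : ℂ) * m (i - 1) j = 0 := by
          rcases Nat.eq_zero_or_pos i with rfl | hi
          · simp
          · rw [(ih (i - 1) (by omega) j).1 (by omega), mul_zero]
        have h2 : ((r ^ 2 * j : ℝ) : ℂ) * m i (j - 1) = 0 := by
          rcases Nat.eq_zero_or_pos j with rfl | hj
          · simp
          · rw [(ih i (by omega) (j - 1)).1 (by omega), mul_zero]
        rw [h1, h2, sub_zero]
      have hr1 := hrec i j
      constructor
      · intro hn
        rw [hlow hn.le, (ih i (by omega) (j + 1)).1 (by omega), mul_zero, zero_sub,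
          neg_eq_zero] at hr1
        exact (mul_eq_zero.1 hr1).resolve_left hj'
      · intro hn
        rw [hlow hn.le, (ih i (by omega) (j + 1)).2 (by omega), sub_eq_zero] at hr1
        apply mul_left_cancel₀ hj'
        rw [← hr1, ← mul_assoc, ← mul_assoc, ← Complex.ofReal_mul, ← Complex.ofReal_mul]
        congr 2
        simp only [ascPochhammer_succ_eval, show 2 * (i + 1) = 2 * i + 2 by ring, pow_add]
        have := (ascPochhammer_pos n lam hlam).ne'
        field_simp
        ring

end

/-! ### The weighted measure on the ellipse -/

section
variable {a b α : ℝ}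

/-- The real-linear coordinate `u = x / a + i y / b`, which maps the ellipse onto the unit disk. -/
noncomputable def ellipseCoord (a b : ℝ) : ℂ →L[ℝ] ℂ :=
  a⁻¹ • (Complex.ofRealCLM ∘L Complex.reCLM) +
    b⁻¹ • (Complex.I • Complex.ofRealCLM ∘L Complex.imCLM)

@[simp] lemma re_ellipseCoord (z : ℂ) : (ellipseCoord a b z).re = z.re / a := by
  simp [ellipseCoord]; ring

@[simp] lemma im_ellipseCoord (z : ℂ) : (ellipseCoord a b z).im = z.im / b := by
  simp [ellipseCoord]; ring

lemma det_ellipseCoord :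
    LinearMap.det (ellipseCoord a b : ℂ →ₗ[ℝ] ℂ) = (a * b)⁻¹ := by
  rw [← LinearMap.det_toMatrix Complex.basisOneI, Matrix.det_fin_two]
  simp [LinearMap.toMatrix_apply]
  ring

lemma normSq_ellipseCoord (z : ℂ) :
    Complex.normSq (ellipseCoord a b z) = ellipseForm a b z := by
  simp [ellipseForm, Complex.normSq_apply]; ring

lemma continuous_ellipseForm : Continuous (ellipseForm a b) := by
  unfold ellipseForm; fun_prop

lemma isOpen_ellipse : IsOpen (ellipse a b) :=
  isOpen_lt continuous_ellipseForm continuous_const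

lemma measurableSet_ellipse : MeasurableSet (ellipse a b) := isOpen_ellipse.measurableSet

lemma measurable_ellipseWeight : Measurable fun z : ℂ =>
    ENNReal.ofReal ((1 + α) * (1 - ellipseForm a b z) ^ α / (Real.pi * a * b)) := by
  have := (continuous_ellipseForm (a := a) (b := b)).measurable
  fun_prop

lemma ellipseWeight_pos (ha : 0 < a) (hb : 0 < b) (hα : -1 < α) {z : ℂ} (hz : z ∈ ellipse a b) :
    0 < (1 + α) * (1 - ellipseForm a b z) ^ α / (Real.pi * a * b) := by
  have h1 : 0 < 1 + α := by linarith
  have h2 : 0 < 1 - ellipseForm a b z := sub_pos.2 hz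
  have := Real.pi_pos
  positivity

lemma integral_ellipseMeasure (ha : 0 < a) (hb : 0 < b) (hα : -1 < α) (f : ℂ → ℂ) :
    ∫ z, f z ∂ellipseMeasure a b α = ∫ z in ellipse a b,
      ((((1 + α) * (1 - ellipseForm a b z) ^ α / (Real.pi * a * b)) : ℝ) : ℂ) * f z := by
  rw [ellipseMeasure, integral_withDensity_eq_integral_toReal_smul measurable_ellipseWeight
    (Filter.Eventually.of_forall fun _ => ENNReal.ofReal_lt_top)]
  refine setIntegral_congr_fun measurableSet_ellipse fun z hz => ?_
  rw [ENNReal.toReal_ofReal (ellipseWeight_pos ha hb hα hz).le, Complex.real_smul]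

lemma integrable_ellipseMeasure (ha : 0 < a) (hb : 0 < b) (hα : -1 < α) (f : ℂ → ℂ) :
    Integrable f (ellipseMeasure a b α) ↔ IntegrableOn (fun z =>
      ((((1 + α) * (1 - ellipseForm a b z) ^ α / (Real.pi * a * b)) : ℝ) : ℂ) * f z)
      (ellipse a b) := by
  rw [ellipseMeasure, integrable_withDensity_iff_integrable_smul' measurable_ellipseWeight
    (Filter.Eventually.of_forall fun _ => ENNReal.ofReal_lt_top)]
  refine integrableOn_congr_fun (fun z hz => ?_) measurableSet_ellipse
  rw [ENNReal.toReal_ofReal (ellipseWeight_pos ha hb hα hz).le, Complex.real_smul]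

lemma ae_mem_ellipse : ∀ᵐ z ∂ellipseMeasure a b α, z ∈ ellipse a b :=
  (withDensity_absolutelyContinuous _ _).ae_le (ae_restrict_mem measurableSet_ellipse)

/-- The radial integral `∫₀¹ y (1 - y²) ^ α dy`. For `α < 0` the integrand is unbounded at `1`;
integrability comes from the continuous monotone primitive. -/
lemma integral_one_sub_sq_rpow (hα : -1 < α) :
    IntegrableOn (fun y : ℝ => y * (1 - y ^ 2) ^ α) (Set.Ioo 0 1) ∧
    ∫ y in Set.Ioo (0:ℝ) 1, y * (1 - y ^ 2) ^ α = 1 / (2 * (1 + α)) := by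
  have h1 : (0:ℝ) < 1 + α := by linarith
  have hd : ∀ y ∈ Set.Ioo (0:ℝ) 1,
      HasDerivAt (fun y : ℝ => - (1 - y ^ 2) ^ (1 + α) / (2 * (1 + α))) (y * (1 - y ^ 2) ^ α) y := by
    intro y hy
    have h2 : 0 < 1 - y ^ 2 := by nlinarith [hy.1, hy.2]
    have := (((hasDerivAt_pow 2 y).const_sub 1).rpow_const (p := 1 + α) (Or.inl h2.ne')).neg.div_const
      (2 * (1 + α))
    refine this.congr_deriv ?_
    rw [add_sub_cancel_left]
    field_simp
    norm_num
    ring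
  have hc : ContinuousOn (fun y : ℝ => - (1 - y ^ 2) ^ (1 + α) / (2 * (1 + α))) (Set.Icc 0 1) := by
    apply ContinuousOn.div_const
    apply ContinuousOn.neg
    apply ContinuousOn.rpow_const (by fun_prop)
    intro x _; right; exact h1.le
  have hi : IntegrableOn (fun y : ℝ => y * (1 - y ^ 2) ^ α) (Set.Ioc 0 1) :=
    intervalIntegral.integrableOn_deriv_of_nonneg hc hd fun y hy => by
      have h2 : 0 < 1 - y ^ 2 := by nlinarith [hy.1, hy.2]
      have := hy.1
      positivity
  refine ⟨hi.mono_set Set.Ioo_subset_Ioc_self, ?_⟩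
  rw [← integral_Ioc_eq_integral_Ioo, ← intervalIntegral.integral_of_le zero_le_one,
    intervalIntegral.integral_eq_sub_of_hasDerivAt_of_le zero_le_one hc hd
      ((intervalIntegrable_iff_integrableOn_Ioc_of_le zero_le_one).2 hi)]
  simp [Real.zero_rpow h1.ne']
  field_simp

lemma integral_ball_one_sub_normSq_rpow (hα : -1 < α) :
    IntegrableOn (fun u : ℂ => (1 - ‖u‖ ^ 2) ^ α) (Metric.ball 0 1) ∧
    ∫ u in Metric.ball (0:ℂ) 1, (1 - ‖u‖ ^ 2) ^ α = Real.pi / (1 + α) := by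
  obtain ⟨hi, he⟩ := integral_one_sub_sq_rpow hα
  constructor
  · rw [integrableOn_fun_norm_addHaar (μ := volume) (f := fun y : ℝ => (1 - y ^ 2) ^ α)]
    simpa using hi
  · have h1 := integral_fun_norm_addHaar (volume : Measure ℂ)
      ((Set.Iio 1).indicator fun y : ℝ => (1 - y ^ 2) ^ α)
    have h2 : ∀ y : ℝ, y ^ (Module.finrank ℝ ℂ - 1) •
      (Set.Iio 1).indicator (fun y : ℝ => (1 - y ^ 2) ^ α) y =
        (Set.Iio 1).indicator (fun y : ℝ => y * (1 - y ^ 2) ^ α) y := by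
      intro y
      by_cases hy : y ∈ Set.Iio (1:ℝ) <;> simp [hy]
    simp_rw [h2] at h1
    rw [setIntegral_indicator measurableSet_Iio, Set.Ioi_inter_Iio, he] at h1
    rw [← integral_indicator Metric.isOpen_ball.measurableSet]
    convert h1 using 1
    · refine integral_congr_ae (Filter.Eventually.of_forall fun u => ?_)
      simp [Set.indicator]
    · have : (1:ℝ) + α ≠ 0 := by linarith
      simp [Measure.real, Complex.volume_ball, NNReal.coe_real_pi]
      field_simp

lemma ellipse_eq_preimage : ellipse a b = ellipseCoord a b ⁻¹' Metric.ball 0 1 := by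
  ext z
  rw [Set.mem_preimage, mem_ball_zero_iff, ← sq_lt_one_iff₀ (norm_nonneg _),
    ← Complex.normSq_eq_norm_sq, normSq_ellipseCoord]
  rfl

lemma integral_ellipse_one_sub_ellipseForm_rpow (ha : 0 < a) (hb : 0 < b) (hα : -1 < α) :
    IntegrableOn (fun z => (1 - ellipseForm a b z) ^ α) (ellipse a b) ∧
    ∫ z in ellipse a b, (1 - ellipseForm a b z) ^ α = a * b * Real.pi / (1 + α) := by
  obtain ⟨hi, he⟩ := integral_ball_one_sub_normSq_rpow hα
  rw [← integrable_indicator_iff Metric.isOpen_ball.measurableSet] at hi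
  rw [← integral_indicator Metric.isOpen_ball.measurableSet] at he
  rw [← integrable_indicator_iff measurableSet_ellipse,
    ← integral_indicator measurableSet_ellipse]
  set F : ℂ → ℝ := (Metric.ball (0 : ℂ) 1).indicator fun u => (1 - ‖u‖ ^ 2) ^ α
  have hF : (ellipse a b).indicator (fun z => (1 - ellipseForm a b z) ^ α) =
      F ∘ ellipseCoord a b := by
    ext z
    rw [ellipse_eq_preimage, Function.comp_apply]
    simp only [Set.indicator, Set.mem_preimage, F]
    rw [← normSq_ellipseCoord, Complex.normSq_eq_norm_sq]
    rfl
  have hmap : Measure.map (ellipseCoord a b) volume = ENNReal.ofReal (a * b) • volume := by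
    have := Measure.map_linearMap_addHaar_eq_smul_addHaar (volume : Measure ℂ)
      (f := (ellipseCoord a b : ℂ →ₗ[ℝ] ℂ)) (by rw [det_ellipseCoord]; positivity)
    rw [det_ellipseCoord, inv_inv, abs_of_pos (by positivity)] at this
    exact this
  have hm : AEMeasurable (ellipseCoord a b) volume := (ellipseCoord a b).continuous.aemeasurable
  have hi' : Integrable F (Measure.map (ellipseCoord a b) volume) := by
    rw [hmap]; exact hi.smul_measure ENNReal.ofReal_ne_top
  rw [hF]
  refine ⟨hi'.comp_aemeasurable hm, ?_⟩
  have := integral_map hm hi'.aestronglyMeasurable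
  simp only [Function.comp_def]
  rw [← this, hmap, integral_smul_measure, he, ENNReal.toReal_ofReal (by positivity)]
  simp only [smul_eq_mul]
  ring

lemma isProbabilityMeasure_ellipseMeasure (ha : 0 < a) (hb : 0 < b) (hα : -1 < α) :
    IsProbabilityMeasure (ellipseMeasure a b α) := by
  obtain ⟨hi, he⟩ := integral_ellipse_one_sub_ellipseForm_rpow ha hb hα
  constructor
  rw [ellipseMeasure, withDensity_apply _ MeasurableSet.univ, Measure.restrict_univ,
    ← ofReal_integral_eq_lintegral_ofReal]
  · simp_rw [mul_div_right_comm]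
    rw [integral_const_mul, he]
    have : (1:ℝ) + α ≠ 0 := by linarith
    have := Real.pi_pos
    rw [ENNReal.ofReal_eq_one]
    field_simp
  · simp_rw [mul_div_right_comm]
    exact hi.const_mul _
  · exact (ae_restrict_mem measurableSet_ellipse).mono fun z hz =>
      (ellipseWeight_pos ha hb hα hz).le

end

/-! ### Integration by parts with a cutoff at the boundary -/

section
variable {a b α : ℝ}
open Filter Topology

lemma isCompact_closedEllipse (ha : 0 < a) (hb : 0 < b) (c : ℝ) :
    IsCompact {z | ellipseForm a b z ≤ c} := by
  refine Metric.isCompact_of_isClosed_isBounded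
    (isClosed_le continuous_ellipseForm continuous_const) ?_
  refine (Metric.isBounded_closedBall (x := (0 : ℂ)) (r := a * √c + b * √c)).subset fun z hz => ?_
  rw [mem_closedBall_zero_iff]
  have hz' : (z.re / a) ^ 2 + (z.im / b) ^ 2 ≤ c := by
    simpa [ellipseForm, div_pow] using hz
  refine (Complex.norm_le_abs_re_add_abs_im z).trans (add_le_add ?_ ?_)
  · have := Real.abs_le_sqrt (show (z.re / a) ^ 2 ≤ c by nlinarith [sq_nonneg (z.im / b)])
    rw [abs_div, abs_of_pos ha, div_le_iff₀ ha] at this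
    linarith
  · have := Real.abs_le_sqrt (show (z.im / b) ^ 2 ≤ c by nlinarith [sq_nonneg (z.re / a)])
    rw [abs_div, abs_of_pos hb, div_le_iff₀ hb] at this
    linarith

lemma integral_fderiv_eq_zero {g : ℂ → ℂ} (hg : ContDiff ℝ 1 g) (hs : HasCompactSupport g)
    (v : ℂ) : ∫ z, fderiv ℝ g z v = 0 := by
  have hc : Continuous fun z => fderiv ℝ g z v :=
    (hg.continuous_fderiv one_ne_zero).clm_apply continuous_const
  have := integral_mul_fderiv_eq_neg_fderiv_mul_of_integrable (μ := (volume : Measure ℂ))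
    (f := fun _ : ℂ => (1 : ℂ)) (g := g) (v := v) (by simp)
    (by simpa using hc.integrable_of_hasCompactSupport (hs.fderiv_apply (𝕜 := ℝ) v))
    (by simpa using hg.continuous.integrable_of_hasCompactSupport hs)
    (fun _ _ => differentiableAt_const _)
    (fun z _ => (hg.differentiable one_ne_zero) z)
  simpa using this

/-- The derivation `κ₁ ∂/∂x + κ₂ ∂/∂y` with complex constant coefficients. For `κ₁ = 1`, `κ₂ = i` it
is twice the Cauchy–Riemann operator. -/
noncomputable def complexDirDeriv (κ₁ κ₂ : ℂ) (g : ℂ → ℂ) (z : ℂ) : ℂ :=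
  κ₁ * fderiv ℝ g z 1 + κ₂ * fderiv ℝ g z Complex.I

variable {κ₁ κ₂ : ℂ} {f g : ℂ → ℂ} {z : ℂ}

lemma complexDirDeriv_mul (hf : DifferentiableAt ℝ f z) (hg : DifferentiableAt ℝ g z) :
    complexDirDeriv κ₁ κ₂ (fun w => f w * g w) z =
      f z * complexDirDeriv κ₁ κ₂ g z + complexDirDeriv κ₁ κ₂ f z * g z := by
  simp only [complexDirDeriv, fderiv_fun_mul hf hg, add_apply,
    smul_apply, smul_eq_mul]
  ring

lemma complexDirDeriv_pow (hf : DifferentiableAt ℝ f z) (n : ℕ) :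
    complexDirDeriv κ₁ κ₂ (fun w => f w ^ n) z =
      n * f z ^ (n - 1) * complexDirDeriv κ₁ κ₂ f z := by
  simp only [complexDirDeriv, fderiv_fun_pow n hf, smul_apply, smul_eq_mul,
    nsmul_eq_mul]
  ring

lemma complexDirDeriv_ofReal_comp {t : ℂ → ℝ} {ψ : ℝ → ℝ} {ψ' : ℝ} (hψ : HasDerivAt ψ ψ' (t z))
    (ht : DifferentiableAt ℝ t z) :
    complexDirDeriv κ₁ κ₂ (fun w => (ψ (t w) : ℂ)) z =
      ψ' * complexDirDeriv κ₁ κ₂ (fun w => (t w : ℂ)) z := by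
  have h1 : HasFDerivAt (fun w => (t w : ℂ)) (Complex.ofRealCLM ∘L fderiv ℝ t z) z :=
    Complex.ofRealCLM.hasFDerivAt.comp z ht.hasFDerivAt
  have h2 : HasFDerivAt (fun w => (ψ (t w) : ℂ)) (Complex.ofRealCLM ∘L (ψ' • fderiv ℝ t z)) z :=
    Complex.ofRealCLM.hasFDerivAt.comp z (hψ.comp_hasFDerivAt z ht.hasFDerivAt)
  simp only [complexDirDeriv, h1.fderiv, h2.fderiv]
  simp
  ring

lemma continuous_complexDirDeriv (hg : ContDiff ℝ 1 g) :
    Continuous (complexDirDeriv κ₁ κ₂ g) := by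
  have h (v : ℂ) : Continuous fun z => fderiv ℝ g z v :=
    (hg.continuous_fderiv one_ne_zero).clm_apply continuous_const
  unfold complexDirDeriv
  exact ((h 1).const_mul _).add ((h Complex.I).const_mul _)

lemma integral_complexDirDeriv_eq_zero (hg : ContDiff ℝ 1 g) (hs : HasCompactSupport g) :
    ∫ z, complexDirDeriv κ₁ κ₂ g z = 0 := by
  have h (v : ℂ) : Integrable fun z => fderiv ℝ g z v :=
    ((hg.continuous_fderiv one_ne_zero).clm_apply
      continuous_const).integrable_of_hasCompactSupport (hs.fderiv_apply (𝕜 := ℝ) v)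
  unfold complexDirDeriv
  rw [integral_add ((h 1).const_mul _) ((h Complex.I).const_mul _), integral_const_mul,
    integral_const_mul, integral_fderiv_eq_zero hg hs, integral_fderiv_eq_zero hg hs]
  simp

lemma hasDerivAt_max_zero_sq (s : ℝ) :
    HasDerivAt (fun s : ℝ => max s 0 ^ 2) (2 * max s 0) s := by
  rcases lt_trichotomy s 0 with hs | rfl | hs
  · rw [max_eq_right hs.le, mul_zero]
    refine (hasDerivAt_const s (0 : ℝ)).congr_of_eventuallyEq ?_
    filter_upwards [gt_mem_nhds hs] with x hx
    rw [max_eq_right hx.le]; norm_num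
  · have h : (fun s : ℝ => max s 0 ^ 2) =O[𝓝 0] fun s => ‖s - 0‖ ^ 2 := by
      refine Asymptotics.IsBigO.of_bound 1 (Eventually.of_forall fun x => ?_)
      rw [one_mul, sub_zero, norm_pow, norm_pow, norm_norm, Real.norm_eq_abs, Real.norm_eq_abs]
      refine pow_le_pow_left₀ (abs_nonneg _) ?_ 2
      rcases le_total x 0 with h | h <;> simp [h]
    simpa using (h.hasFDerivAt (𝕜 := ℝ) one_lt_two).hasDerivAt
  · rw [max_eq_left hs.le]
    refine (by simpa using hasDerivAt_pow 2 s : HasDerivAt (fun s : ℝ => s ^ 2) (2 * s) s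
      ).congr_of_eventuallyEq ?_
    filter_upwards [lt_mem_nhds hs] with x hx
    rw [max_eq_left hx.le]

lemma contDiff_max_zero_sq : ContDiff ℝ 1 fun s : ℝ => max s 0 ^ 2 := by
  rw [contDiff_one_iff_deriv]
  refine ⟨fun s => (hasDerivAt_max_zero_sq s).differentiableAt, ?_⟩
  rw [funext fun s => (hasDerivAt_max_zero_sq s).deriv]
  fun_prop

/-- A truncation of `t ^ lam` which vanishes for `t ≤ ε` and is `C¹` on `(0, ∞)`, namely
`t ^ lam * (1 - ε / t)₊ ^ 2`. -/
noncomputable def cutoffRpow (lam ε t : ℝ) : ℝ := max (t - ε) 0 ^ 2 * t ^ (lam - 2)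

lemma cutoffRpow_of_le {lam ε t : ℝ} (h : t ≤ ε) : cutoffRpow lam ε t = 0 := by
  rw [cutoffRpow, max_eq_right (by linarith)]; simp

lemma cutoffRpow_eq {α ε t : ℝ} (ht : 0 < t) :
    cutoffRpow (1 + α) ε t = t ^ α * (t * max (1 - ε / t) 0 ^ 2) := by
  have h : max (t - ε) 0 = t * max (1 - ε / t) 0 := by
    rw [mul_max_of_nonneg _ _ ht.le, mul_zero]; congr 1; field_simp
  rw [cutoffRpow, h, show 1 + α - 2 = α - 1 by ring, Real.rpow_sub_one ht.ne']
  field_simp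

/-- The derivative of the cutoff is `t ^ α` times a factor that is bounded uniformly in `ε` and tends
to `1 + α` as `ε → 0`. This lets the weight `t ^ α` absorb the boundary terms, also for `α < 0`. -/
lemma hasDerivAt_cutoffRpow {α ε t : ℝ} (ht : 0 < t) :
    HasDerivAt (cutoffRpow (1 + α) ε)
      (t ^ α * (2 * max (1 - ε / t) 0 + (α - 1) * max (1 - ε / t) 0 ^ 2)) t := by
  have h : max (t - ε) 0 = t * max (1 - ε / t) 0 := by
    rw [mul_max_of_nonneg _ _ ht.le, mul_zero]; congr 1; field_simp
  have h1 := ((hasDerivAt_max_zero_sq (t - ε)).comp t ((hasDerivAt_id t).sub_const ε)).mul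
    (Real.hasDerivAt_rpow_const (p := 1 + α - 2) (Or.inl ht.ne'))
  refine h1.congr_deriv ?_
  simp only [Function.comp_apply, id, h]
  rw [show 1 + α - 2 - 1 = α - 1 - 1 by ring, show 1 + α - 2 = α - 1 by ring,
    Real.rpow_sub_one ht.ne' (α - 1), Real.rpow_sub_one ht.ne' α]
  field_simp

lemma contDiffAt_cutoffRpow {lam ε t : ℝ} (ht : 0 < t) : ContDiffAt ℝ 1 (cutoffRpow lam ε) t := by
  unfold cutoffRpow
  refine ContDiffAt.mul ?_ (Real.contDiffAt_rpow_const_of_ne ht.ne')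
  exact contDiff_max_zero_sq.contDiffAt.comp t (contDiffAt_id.sub contDiffAt_const)

lemma contDiff_ellipseForm {n : WithTop ℕ∞} : ContDiff ℝ n (ellipseForm a b) := by
  have h1 : ContDiff ℝ n Complex.re := Complex.reCLM.contDiff
  have h2 : ContDiff ℝ n Complex.im := Complex.imCLM.contDiff
  unfold ellipseForm
  fun_prop

/-- A function that is `C¹` on the ellipse only becomes `C¹` on the whole plane after multiplication by
the cutoff, whatever its values off the ellipse. -/
lemma contDiff_mul_cutoffRpow {lam ε : ℝ} (hε : 0 < ε) (hg : ContDiffOn ℝ 1 g (ellipse a b)) :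
    ContDiff ℝ 1 fun z => g z * (cutoffRpow lam ε (1 - ellipseForm a b z) : ℂ) := by
  rw [contDiff_iff_contDiffAt]
  intro z
  by_cases hz : z ∈ ellipse a b
  · refine (hg.contDiffAt (isOpen_ellipse.mem_nhds hz)).mul ?_
    refine Complex.ofRealCLM.contDiff.contDiffAt.comp z ?_
    exact (contDiffAt_cutoffRpow (sub_pos.2 hz)).comp z
      (contDiffAt_const.sub contDiff_ellipseForm.contDiffAt)
  · have hz' : 1 - ε < ellipseForm a b z := by
      have : 1 ≤ ellipseForm a b z := not_lt.1 hz
      linarith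
    refine (contDiffAt_const (c := (0 : ℂ))).congr_of_eventuallyEq ?_
    filter_upwards [continuous_ellipseForm.continuousAt.eventually (lt_mem_nhds hz')] with w hw
    rw [cutoffRpow_of_le (by linarith)]; simp

lemma hasCompactSupport_mul_cutoffRpow (ha : 0 < a) (hb : 0 < b) {lam ε : ℝ} (g : ℂ → ℂ) :
    HasCompactSupport fun z => g z * (cutoffRpow lam ε (1 - ellipseForm a b z) : ℂ) := by
  refine HasCompactSupport.intro (isCompact_closedEllipse ha hb (1 - ε)) fun z hz => ?_
  rw [Set.mem_ofPred_eq, not_le] at hz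
  rw [cutoffRpow_of_le (by linarith)]; simp

/-- The integral of the derivative of the compactly supported function `f * g * cutoff` vanishes; here
it is rewritten as an integral against the weighted measure. -/
lemma integral_mul_cutoff_eq_zero (ha : 0 < a) (hb : 0 < b) (hα : -1 < α)
    (hf : ContDiffOn ℝ 1 f (ellipse a b))
    (hD : ∀ z ∈ ellipse a b, complexDirDeriv κ₁ κ₂ f z = 0) (hg : ContDiff ℝ 1 g)
    {ε : ℝ} (hε : 0 < ε) :
    ∫ z, f z * (complexDirDeriv κ₁ κ₂ g z *
          (((1 - ellipseForm a b z) * max (1 - ε / (1 - ellipseForm a b z)) 0 ^ 2 : ℝ) : ℂ) +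
        g z * ((2 * max (1 - ε / (1 - ellipseForm a b z)) 0 +
          (α - 1) * max (1 - ε / (1 - ellipseForm a b z)) 0 ^ 2 : ℝ) : ℂ) *
          complexDirDeriv κ₁ κ₂ (fun z => ((1 - ellipseForm a b z : ℝ) : ℂ)) z)
      ∂ellipseMeasure a b α = 0 := by
  have h1 := integral_complexDirDeriv_eq_zero (κ₁ := κ₁) (κ₂ := κ₂)
    (contDiff_mul_cutoffRpow (lam := 1 + α) hε (hf.mul hg.contDiffOn))
    (hasCompactSupport_mul_cutoffRpow ha hb (lam := 1 + α) (ε := ε) _)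
  rw [integral_ellipseMeasure ha hb hα, ← mul_zero (((1 + α) / (Real.pi * a * b) : ℝ) : ℂ), ← h1,
    ← integral_const_mul, ← integral_indicator measurableSet_ellipse]
  refine integral_congr_ae (Eventually.of_forall fun z => ?_)
  by_cases hz : z ∈ ellipse a b
  · have ht : 0 < 1 - ellipseForm a b z := sub_pos.2 hz
    have hf' : DifferentiableAt ℝ f z :=
      (hf.contDiffAt (isOpen_ellipse.mem_nhds hz)).differentiableAt one_ne_zero
    have hg' : DifferentiableAt ℝ g z := hg.differentiable one_ne_zero z
    have ht' : DifferentiableAt ℝ (fun z => 1 - ellipseForm a b z) z :=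
      (contDiff_const.sub (contDiff_ellipseForm (n := 1))).differentiable one_ne_zero z
    have hψ := hasDerivAt_cutoffRpow (α := α) (ε := ε) ht
    have hψ' : DifferentiableAt ℝ
        (fun z => (cutoffRpow (1 + α) ε (1 - ellipseForm a b z) : ℂ)) z :=
      Complex.ofRealCLM.differentiableAt.comp z
        (hψ.differentiableAt.comp z (f := fun z => 1 - ellipseForm a b z) ht')
    simp only [Set.indicator_of_mem hz]
    rw [complexDirDeriv_mul (hf'.fun_mul hg') hψ', complexDirDeriv_mul hf' hg', hD z hz,
      complexDirDeriv_ofReal_comp hψ ht', cutoffRpow_eq ht]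
    push_cast
    ring
  · simp only [Set.indicator_of_notMem hz]
    have hz' : 1 - ε < ellipseForm a b z := by
      have : 1 ≤ ellipseForm a b z := not_lt.1 hz
      linarith
    have : (fun z => f z * g z * (cutoffRpow (1 + α) ε (1 - ellipseForm a b z) : ℂ)) =ᶠ[𝓝 z]
        fun _ => 0 := by
      filter_upwards [continuous_ellipseForm.continuousAt.eventually (lt_mem_nhds hz')] with w hw
      rw [cutoffRpow_of_le (by linarith)]; simp
    have h2 : complexDirDeriv κ₁ κ₂
      (fun z => f z * g z * (cutoffRpow (1 + α) ε (1 - ellipseForm a b z) : ℂ)) z = 0 := by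
      rw [complexDirDeriv, this.fderiv_eq]; simp
    exact (mul_eq_zero_of_right _ h2).symm

end

/-! ### Recurrence for the moments -/

section
variable {a b α : ℝ}
open Filter Topology
open scoped ComplexConjugate
variable {κ₁ κ₂ : ℂ} {f g : ℂ → ℂ} {z : ℂ}

lemma ellipseForm_nonneg (z : ℂ) : 0 ≤ ellipseForm a b z := by
  unfold ellipseForm; positivity

lemma ae_ellipseMeasure_iff (ha : 0 < a) (hb : 0 < b) (hα : -1 < α) {p : ℂ → Prop} :
    (∀ᵐ z ∂ellipseMeasure a b α, p z) ↔ ∀ᵐ z ∂volume.restrict (ellipse a b), p z := by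
  rw [ellipseMeasure, ae_withDensity_iff measurable_ellipseWeight]
  refine ⟨fun h => ?_, fun h => h.mono fun z hz _ => hz⟩
  filter_upwards [h, ae_restrict_mem measurableSet_ellipse] with z hz hzE
  exact hz (ENNReal.ofReal_pos.2 (ellipseWeight_pos ha hb hα hzE)).ne'

lemma aestronglyMeasurable_of_continuousOn_ellipse
    (hf : ContinuousOn f (ellipse a b)) : AEStronglyMeasurable f (ellipseMeasure a b α) :=
  (hf.aestronglyMeasurable measurableSet_ellipse).mono_ac (withDensity_absolutelyContinuous _ _)

lemma exists_norm_le_of_continuous (ha : 0 < a) (hb : 0 < b) (hg : Continuous g) :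
    ∃ C, ∀ z ∈ ellipse a b, ‖g z‖ ≤ C := by
  obtain ⟨C, hC⟩ := (isCompact_closedEllipse ha hb 1).exists_bound_of_continuousOn hg.continuousOn
  exact ⟨C, fun z hz => hC z (show ellipseForm a b z ≤ 1 from le_of_lt hz)⟩

/-- Integration by parts: if the derivation `D = κ₁ ∂/∂x + κ₂ ∂/∂y` annihilates the integrable
function `f`, then `f` is orthogonal to `t⁻ᵅ D (t ^ (1 + α) g) = t D g + (1 + α) g D t`, where
`t = 1 - h`. There is no boundary condition on `f`. -/
lemma integral_mul_weighted_adjoint_eq_zero (ha : 0 < a) (hb : 0 < b) (hα : -1 < α)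
    (hf : ContDiffOn ℝ 1 f (ellipse a b)) (hfi : Integrable f (ellipseMeasure a b α))
    (hD : ∀ z ∈ ellipse a b, complexDirDeriv κ₁ κ₂ f z = 0) (hg : ContDiff ℝ 1 g) :
    ∫ z, f z * (complexDirDeriv κ₁ κ₂ g z * ((1 - ellipseForm a b z : ℝ) : ℂ) +
        g z * ((1 + α : ℝ) : ℂ) *
          complexDirDeriv κ₁ κ₂ (fun z => ((1 - ellipseForm a b z : ℝ) : ℂ)) z)
      ∂ellipseMeasure a b α = 0 := by
  have hT : ContDiff ℝ 1 fun z => ((1 - ellipseForm a b z : ℝ) : ℂ) :=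
    Complex.ofRealCLM.contDiff.comp (contDiff_const.sub contDiff_ellipseForm)
  have hDg := continuous_complexDirDeriv (κ₁ := κ₁) (κ₂ := κ₂) hg
  have hDT := continuous_complexDirDeriv (κ₁ := κ₁) (κ₂ := κ₂) hT
  obtain ⟨C₁, hC₁⟩ := exists_norm_le_of_continuous ha hb hDg
  obtain ⟨C₂, hC₂⟩ := exists_norm_le_of_continuous ha hb (hg.continuous.mul hDT)
  set ε : ℕ → ℝ := fun n => 1 / ((n : ℝ) + 1)
  have hε (n : ℕ) : 0 < ε n := by positivity
  refine tendsto_nhds_unique (l := atTop) ?_ (tendsto_const_nhds.congr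
    fun n => (integral_mul_cutoff_eq_zero ha hb hα hf hD hg (hε n)).symm)
  have hη (n : ℕ) : ∀ z ∈ ellipse a b, max (1 - ε n / (1 - ellipseForm a b z)) 0 ≤ 1 := by
    intro z hz
    have ht : 0 < 1 - ellipseForm a b z := sub_pos.2 hz
    refine max_le ?_ zero_le_one
    have : 0 < ε n / (1 - ellipseForm a b z) := div_pos (hε n) ht
    linarith
  refine tendsto_integral_of_dominated_convergence (fun z => ‖f z‖ * (C₁ + C₂ * (2 + |α - 1|)))
    (fun n => ?_) (hfi.norm.mul_const _) (fun n => ?_) ?_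
  · refine aestronglyMeasurable_of_continuousOn_ellipse ?_
    have h1 : ContinuousOn (fun z => max (1 - ε n / (1 - ellipseForm a b z)) 0) (ellipse a b) := by
      refine ContinuousOn.sup ?_ continuousOn_const
      refine continuousOn_const.sub (continuousOn_const.div ?_ fun z hz => (sub_pos.2 hz).ne')
      exact (continuous_const.sub continuous_ellipseForm).continuousOn
    have h2 := (continuous_ellipseForm (a := a) (b := b)).continuousOn (s := ellipse a b)
    refine hf.continuousOn.mul (ContinuousOn.add (hDg.continuousOn.mul ?_)
      ((hg.continuous.continuousOn.mul ?_).mul hDT.continuousOn))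
    · exact Complex.continuous_ofReal.comp_continuousOn ((continuousOn_const.sub h2).mul (h1.pow 2))
    · exact Complex.continuous_ofReal.comp_continuousOn
        ((continuousOn_const.mul h1).add (continuousOn_const.mul (h1.pow 2)))
  · refine ae_mem_ellipse.mono fun z hz => ?_
    rw [norm_mul]
    refine mul_le_mul_of_nonneg_left ?_ (norm_nonneg _)
    set η := max (1 - ε n / (1 - ellipseForm a b z)) 0
    have hη0 : 0 ≤ η := le_max_right _ _
    have hη1 : η ≤ 1 := hη n z hz
    have hη2 : η ^ 2 ≤ 1 := pow_le_one₀ hη0 hη1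
    have ht0 : 0 < 1 - ellipseForm a b z := sub_pos.2 hz
    have ht1 : 1 - ellipseForm a b z ≤ 1 := by linarith [ellipseForm_nonneg (a := a) (b := b) z]
    refine (norm_add_le _ _).trans (add_le_add ?_ ?_)
    · rw [norm_mul, Complex.norm_real, Real.norm_of_nonneg (by positivity)]
      calc _ ≤ ‖complexDirDeriv κ₁ κ₂ g z‖ * 1 := by
            refine mul_le_mul_of_nonneg_left ?_ (norm_nonneg _)
            exact mul_le_one₀ ht1 (by positivity) hη2
        _ ≤ C₁ := by rw [mul_one]; exact hC₁ z hz
    · rw [mul_right_comm, norm_mul, Complex.norm_real]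
      refine mul_le_mul (hC₂ z hz) ?_ (norm_nonneg _) ((norm_nonneg _).trans (hC₂ z hz))
      refine (norm_add_le _ _).trans (add_le_add ?_ ?_)
      · rw [Real.norm_of_nonneg (by positivity)]; linarith
      · rw [norm_mul, Real.norm_eq_abs, Real.norm_of_nonneg (by positivity)]
        exact mul_le_of_le_one_right (abs_nonneg _) hη2
  · refine ae_mem_ellipse.mono fun z hz => ?_
    have h1 : Tendsto (fun n => max (1 - ε n / (1 - ellipseForm a b z)) 0) atTop (𝓝 1) := by
      have : Tendsto (fun n => max (1 - ε n / (1 - ellipseForm a b z)) 0) atTop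
          (𝓝 (max (1 - 0 / (1 - ellipseForm a b z)) 0)) :=
        (tendsto_const_nhds.sub (tendsto_one_div_add_atTop_nhds_zero_nat.div_const _)).max
          tendsto_const_nhds
      simpa using this
    refine Tendsto.const_mul _ ((Tendsto.const_mul _ ?_).add ((Tendsto.const_mul _ ?_).mul_const _))
    · refine (Complex.continuous_ofReal.tendsto _).comp ?_
      simpa using (h1.pow 2).const_mul (1 - ellipseForm a b z)
    · refine (Complex.continuous_ofReal.tendsto _).comp ?_
      convert (h1.const_mul 2).add ((h1.pow 2).const_mul (α - 1)) using 2
      ring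

lemma complexDirDeriv_ellipseCoord :
    complexDirDeriv κ₁ κ₂ (ellipseCoord a b) z = κ₁ / a + κ₂ * Complex.I / b := by
  rw [complexDirDeriv, (ellipseCoord a b).hasFDerivAt.fderiv]
  simp [ellipseCoord]; ring

lemma hasFDerivAt_conj_ellipseCoord : HasFDerivAt (fun w => conj (ellipseCoord a b w))
    ((Complex.conjCLE : ℂ →L[ℝ] ℂ) ∘L ellipseCoord a b) z :=
  ((Complex.conjCLE : ℂ →L[ℝ] ℂ) ∘L ellipseCoord a b).hasFDerivAt

lemma complexDirDeriv_conj_ellipseCoord :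
    complexDirDeriv κ₁ κ₂ (fun w => conj (ellipseCoord a b w)) z =
      κ₁ / a - κ₂ * Complex.I / b := by
  rw [complexDirDeriv, hasFDerivAt_conj_ellipseCoord.fderiv]
  simp [ellipseCoord]; ring

lemma ofReal_one_sub_ellipseForm (z : ℂ) : ((1 - ellipseForm a b z : ℝ) : ℂ) =
    1 - ellipseCoord a b z * conj (ellipseCoord a b z) := by
  rw [Complex.mul_conj, normSq_ellipseCoord]; push_cast; rfl

/-- The moment `∫ f u ^ i (conj u) ^ j dA_α`, where `u = x / a + i y / b`. -/
noncomputable def ellipseMoment (a b α : ℝ) (f : ℂ → ℂ) (i j : ℕ) : ℂ :=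
  ∫ z, f z * (ellipseCoord a b z ^ i * conj (ellipseCoord a b z) ^ j) ∂ellipseMeasure a b α

lemma integrable_mul_of_continuous (ha : 0 < a) (hb : 0 < b)
    (hfi : Integrable f (ellipseMeasure a b α)) (hg : Continuous g) :
    Integrable (fun z => f z * g z) (ellipseMeasure a b α) := by
  obtain ⟨C, hC⟩ := exists_norm_le_of_continuous ha hb hg
  exact hfi.mul_bdd hg.aestronglyMeasurable (ae_mem_ellipse.mono fun z hz => hC z hz)

lemma integrable_mul_monomial (ha : 0 < a) (hb : 0 < b)
    (hfi : Integrable f (ellipseMeasure a b α)) (i j : ℕ) :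
    Integrable (fun z => f z * (ellipseCoord a b z ^ i * conj (ellipseCoord a b z) ^ j))
      (ellipseMeasure a b α) :=
  integrable_mul_of_continuous ha hb hfi (by fun_prop)

/-- Integration by parts against the monomial `u ^ i (conj u) ^ j`. -/
lemma ellipseMoment_recurrence_of_complexDirDeriv (ha : 0 < a) (hb : 0 < b) (hα : -1 < α)
    (hf : ContDiffOn ℝ 1 f (ellipse a b)) (hfi : Integrable f (ellipseMeasure a b α))
    (hD : ∀ z ∈ ellipse a b, complexDirDeriv κ₁ κ₂ f z = 0) (i j : ℕ) :
    (κ₁ / a + κ₂ * Complex.I / b) * (i * ellipseMoment a b α f (i - 1) j) +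
      (κ₁ / a - κ₂ * Complex.I / b) * (j * ellipseMoment a b α f i (j - 1)) =
    (κ₁ / a + κ₂ * Complex.I / b) * ((i + (1 + α : ℝ)) * ellipseMoment a b α f i (j + 1)) +
      (κ₁ / a - κ₂ * Complex.I / b) * ((j + (1 + α : ℝ)) * ellipseMoment a b α f (i + 1) j) := by
  have hU : ContDiff ℝ 1 (ellipseCoord a b) := (ellipseCoord a b).contDiff
  have hV : ContDiff ℝ 1 fun w => conj (ellipseCoord a b w) :=
    ((Complex.conjCLE : ℂ →L[ℝ] ℂ) ∘L ellipseCoord a b).contDiff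
  have hUd : Differentiable ℝ (ellipseCoord a b) := hU.differentiable one_ne_zero
  have hVd : Differentiable ℝ fun w => conj (ellipseCoord a b w) := hV.differentiable one_ne_zero
  have key := integral_mul_weighted_adjoint_eq_zero (κ₁ := κ₁) (κ₂ := κ₂) ha hb hα hf hfi hD
    ((hU.pow i).mul (hV.pow j))
  have hI := integrable_mul_monomial ha hb hfi
  set A := κ₁ / a + κ₂ * Complex.I / b with hA
  set B := κ₁ / a - κ₂ * Complex.I / b with hB
  have hI' (c d : ℂ) (i j k l : ℕ) : Integrable (fun z =>
      A * (c * (f z * (ellipseCoord a b z ^ i * conj (ellipseCoord a b z) ^ j))) +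
      B * (d * (f z * (ellipseCoord a b z ^ k * conj (ellipseCoord a b z) ^ l))))
      (ellipseMeasure a b α) :=
    (((hI i j).const_mul c).const_mul A).add (((hI k l).const_mul d).const_mul B)
  rw [← sub_eq_zero, ← key]
  unfold ellipseMoment
  simp only [← integral_const_mul]
  rw [← integral_add (((hI _ _).const_mul _).const_mul _) (((hI _ _).const_mul _).const_mul _),
    ← integral_add (((hI _ _).const_mul _).const_mul _) (((hI _ _).const_mul _).const_mul _),
    ← integral_sub (hI' _ _ _ _ _ _) (hI' _ _ _ _ _ _)]
  congr 1 with z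
  have h1 : complexDirDeriv κ₁ κ₂ (fun z => ((1 - ellipseForm a b z : ℝ) : ℂ)) z =
      -(ellipseCoord a b z * B + A * conj (ellipseCoord a b z)) := by
    simp only [ofReal_one_sub_ellipseForm]
    have : complexDirDeriv κ₁ κ₂
        (fun z => 1 - ellipseCoord a b z * conj (ellipseCoord a b z)) z =
        - complexDirDeriv κ₁ κ₂ (fun z => ellipseCoord a b z * conj (ellipseCoord a b z)) z := by
      simp only [complexDirDeriv, fderiv_const_sub, neg_apply]
      ring
    rw [this, complexDirDeriv_mul (hUd z) (hVd z), complexDirDeriv_ellipseCoord,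
      complexDirDeriv_conj_ellipseCoord]
  rw [h1, complexDirDeriv_mul ((hUd z).fun_pow i) ((hVd z).fun_pow j), complexDirDeriv_pow (hUd z),
    complexDirDeriv_pow (hVd z), complexDirDeriv_ellipseCoord, complexDirDeriv_conj_ellipseCoord,
    ofReal_one_sub_ellipseForm, ← hA, ← hB]
  generalize ellipseCoord a b z = u
  generalize conj u = v
  clear_value A B
  rcases i with _ | i <;> rcases j with _ | j <;>
    simp only [Nat.add_sub_cancel, Nat.cast_zero, Nat.cast_add, Nat.cast_one] <;> ring

end

/-! ### Moments against Gegenbauer polynomials -/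

section
variable {a b α : ℝ}
open Finset (range)
open Finset.HasAntidiagonal (antidiagonal)
open scoped ComplexConjugate
variable {f : ℂ → ℂ}

lemma complexDirDeriv_eq_zero_of_differentiableAt {z : ℂ} (hf : DifferentiableAt ℂ f z) :
    complexDirDeriv 1 Complex.I f z = 0 := by
  have h := hf.hasDerivAt.hasFDerivAt.restrictScalars ℝ
  rw [complexDirDeriv, h.fderiv]
  simp only [ContinuousLinearMap.coe_restrictScalars', ContinuousLinearMap.toSpanSingleton_apply,
    smul_eq_mul]
  linear_combination deriv f z * Complex.I_mul_I

lemma complexDirDeriv_one (κ₁ κ₂ z : ℂ) : complexDirDeriv κ₁ κ₂ (fun _ => 1) z = 0 := by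
  simp [complexDirDeriv]

/-- The moment recurrence of a holomorphic function, from the Cauchy–Riemann operator. The square of
`r = (a + b) / c` is the ratio of the values of that operator at `conj u` and at `-u`. -/
lemma ellipseMoment_recurrence (hb : 0 < b) (hab : b < a) (hα : -1 < α)
    (hf : DifferentiableOn ℂ f (ellipse a b)) (hfi : Integrable f (ellipseMeasure a b α))
    (i j : ℕ) :
    ((i + (1 + α) : ℝ) : ℂ) * ellipseMoment a b α f i (j + 1) -
      ((((a + b) / √(a ^ 2 - b ^ 2)) ^ 2 * (j + (1 + α)) : ℝ) : ℂ) *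
        ellipseMoment a b α f (i + 1) j =
    i * ellipseMoment a b α f (i - 1) j -
      ((((a + b) / √(a ^ 2 - b ^ 2)) ^ 2 * j : ℝ) : ℂ) * ellipseMoment a b α f i (j - 1) := by
  have ha : 0 < a := hb.trans hab
  have h := ellipseMoment_recurrence_of_complexDirDeriv ha hb hα
    ((hf.contDiffOn (n := 1) isOpen_ellipse).restrict_scalars ℝ) hfi
    (fun z hz => complexDirDeriv_eq_zero_of_differentiableAt
      (hf.differentiableAt (isOpen_ellipse.mem_nhds hz))) i j
  have hsq : 0 < a ^ 2 - b ^ 2 := by nlinarith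
  rw [div_pow, Real.sq_sqrt hsq.le, show (a + b) ^ 2 / (a ^ 2 - b ^ 2) = (a + b) / (a - b) by
    rw [div_eq_div_iff hsq.ne' (sub_pos.2 hab).ne']; ring]
  have h1 : (a : ℂ) ≠ 0 := by exact_mod_cast ha.ne'
  have h2 : (b : ℂ) ≠ 0 := by exact_mod_cast hb.ne'
  have h3 : (a : ℂ) - b ≠ 0 := by exact_mod_cast (sub_pos.2 hab).ne'
  rw [Complex.I_mul_I] at h
  field_simp at h
  push_cast at h ⊢
  field_simp
  linear_combination h

/-- The moments of the constant function `1`, from the recurrences of the derivations that annihilate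
`u` or `conj u`; only the total mass has to be integrated. -/
lemma ellipseMoment_one (ha : 0 < a) (hb : 0 < b) (hα : -1 < α) (i j : ℕ) :
    ellipseMoment a b α (fun _ => 1) i j = diskMoment (1 + α) i j := by
  have := isProbabilityMeasure_ellipseMeasure ha hb hα
  have hrec (κ₁ κ₂ : ℂ) (i j : ℕ) := ellipseMoment_recurrence_of_complexDirDeriv
    (κ₁ := κ₁) (κ₂ := κ₂) (f := fun _ => 1) ha hb hα contDiffOn_const (integrable_const _)
    (fun z _ => complexDirDeriv_one _ _ _) i j
  have h1 : (a : ℂ) ≠ 0 := by exact_mod_cast ha.ne'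
  have h2 : (b : ℂ) ≠ 0 := by exact_mod_cast hb.ne'
  have hII : Complex.I * b * Complex.I / b = -1 := by
    rw [mul_right_comm, Complex.I_mul_I]; field_simp
  -- `hA` belongs to the derivation that annihilates `u`, `hB` to the one that annihilates `conj u`.
  have hA (i j : ℕ) := hrec a (Complex.I * b) i j
  have hB (i j : ℕ) := hrec a (-(Complex.I * b)) i j
  simp only [neg_mul, neg_div, hII, div_self h1] at hA hB
  norm_num at hA hB
  have hpos (i : ℕ) : (i : ℂ) + (1 + α) ≠ 0 := by
    have : (0 : ℝ) < i + (1 + α) := by have := i.cast_nonneg (α := ℝ); linarith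
    exact_mod_cast this.ne'
  induction i generalizing j with
  | zero =>
    cases j with
    | zero => simp [ellipseMoment, diskMoment]
    | succ j =>
      have := hB 0 j
      have h0 := hpos 0
      simp only [Nat.cast_zero, zero_mul, zero_add, zero_eq_mul] at this h0
      simp [this.resolve_left h0, diskMoment]
  | succ i ih =>
    cases j with
    | zero =>
      have := hA i 0
      have h0 := hpos 0
      simp only [Nat.cast_zero, zero_mul, zero_add, zero_eq_mul] at this h0
      simp [this.resolve_left h0, diskMoment]
    | succ j =>
      have h := hA i (j + 1)
      rw [Nat.add_sub_cancel, ih j] at h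
      apply mul_left_cancel₀ (hpos (j + 1))
      rw [← h, diskMoment, diskMoment]
      by_cases hij : i = j
      · subst hij
        simp only [if_true, Nat.factorial_succ, ascPochhammer_succ_eval]
        have h3 := (ascPochhammer_pos i (1 + α + 1) (by linarith)).ne'
        have h4 : (1 : ℝ) + α + 1 + i ≠ 0 := by
          have := i.cast_nonneg (α := ℝ); linarith
        norm_cast
        field_simp
        push_cast
        ring
      · simp [hij]

/-- The function `C_n^{(lam)}(z / c)` with `c = √(a² - b²)`, before normalization. -/
noncomputable def ellipseGegenbauer (a b lam : ℝ) (n : ℕ) (z : ℂ) : ℂ :=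
  aeval (z / (√(a ^ 2 - b ^ 2) : ℂ)) (gegenbauer lam n)

/-- With `r = (a + b) / c` one has `2 z / c = r u + r⁻¹ conj u`. -/
lemma two_mul_div_sqrt (hb : 0 < b) (hab : b < a) (z : ℂ) :
    2 * (z / (√(a ^ 2 - b ^ 2) : ℂ)) =
      (((a + b) / √(a ^ 2 - b ^ 2) : ℝ) : ℂ) * ellipseCoord a b z +
      (((a + b) / √(a ^ 2 - b ^ 2) : ℝ) : ℂ)⁻¹ * conj (ellipseCoord a b z) := by
  have ha : 0 < a := hb.trans hab
  have hsq : 0 < a ^ 2 - b ^ 2 := by nlinarith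
  have hc : 0 < √(a ^ 2 - b ^ 2) := Real.sqrt_pos.2 hsq
  have hc2 := Real.sq_sqrt hsq.le
  set c := √(a ^ 2 - b ^ 2)
  have hinv : ((a + b) / c)⁻¹ = (a - b) / c := by
    have : a + b ≠ 0 := by positivity
    field_simp
    nlinarith
  rw [← Complex.ofReal_inv, hinv]
  apply Complex.ext
  · simp [Complex.div_ofReal_re, Complex.div_ofReal_im, -Complex.ofReal_div]
    field_simp; ring
  · simp [Complex.div_ofReal_re, Complex.div_ofReal_im, -Complex.ofReal_div]
    field_simp; ring

lemma ellipseGegenbauer_eq_sum (hb : 0 < b) (hab : b < a) (lam : ℝ) (n : ℕ) (z : ℂ) :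
    ellipseGegenbauer a b lam n z =
      ∑ k ∈ range (n / 2 + 1), ∑ p ∈ antidiagonal (n - 2 * k),
        (((-1) ^ k * (ascPochhammer ℝ (n - k)).eval lam /
          (k.factorial * p.1.factorial * p.2.factorial) *
          (((a + b) / √(a ^ 2 - b ^ 2)) ^ p.1 * ((a + b) / √(a ^ 2 - b ^ 2))⁻¹ ^ p.2) : ℝ) : ℂ) *
        (ellipseCoord a b z ^ p.1 * conj (ellipseCoord a b z) ^ p.2) := by
  rw [ellipseGegenbauer, aeval_gegenbauer lam n (two_mul_div_sqrt hb hab z)]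
  refine Finset.sum_congr rfl fun k _ => Finset.sum_congr rfl fun p _ => ?_
  rw [Complex.real_smul, mul_pow, mul_pow]
  push_cast
  ring

lemma differentiable_ellipseGegenbauer (lam : ℝ) (n : ℕ) :
    Differentiable ℂ (ellipseGegenbauer a b lam n) := by
  unfold ellipseGegenbauer
  exact (Polynomial.differentiable_aeval (𝕜 := ℂ) (gegenbauer lam n)).comp
    (show Differentiable ℂ fun z : ℂ => z / (√(a ^ 2 - b ^ 2) : ℂ) by fun_prop)

lemma integrable_of_continuous (ha : 0 < a) (hb : 0 < b) (hα : -1 < α) (hf : Continuous f) :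
    Integrable f (ellipseMeasure a b α) := by
  have := isProbabilityMeasure_ellipseMeasure ha hb hα
  simpa using integrable_mul_of_continuous ha hb (integrable_const (1 : ℂ)) hf

lemma ellipseMoment_ellipseGegenbauer (hb : 0 < b) (hab : b < a) (hα : -1 < α) {m n : ℕ}
    (hmn : m ≤ n) :
    ellipseMoment a b α (ellipseGegenbauer a b (1 + α) n) 0 m =
      if m = n then ((((a + b) / √(a ^ 2 - b ^ 2)) ^ n * ((1 + α) / (1 + α + n)) : ℝ) : ℂ)
      else 0 := by
  have ha : 0 < a := hb.trans hab
  have hsq : 0 < a ^ 2 - b ^ 2 := by nlinarith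
  have hr : 0 < (a + b) / √(a ^ 2 - b ^ 2) := div_pos (by positivity) (Real.sqrt_pos.2 hsq)
  have hI (i j : ℕ) : Integrable (fun z => ellipseCoord a b z ^ i * conj (ellipseCoord a b z) ^ j)
      (ellipseMeasure a b α) := integrable_of_continuous ha hb hα (by fun_prop)
  have h1 := sum_gegenbauer_coeff_mul_diskMoment (lam := 1 + α) (by linarith) hr hmn
  have h2 := congrArg (Complex.ofReal) h1
  rw [apply_ite Complex.ofReal, Complex.ofReal_zero] at h2
  rw [← h2, ellipseMoment, Complex.ofReal_sum]
  simp_rw [Complex.ofReal_sum, ellipseGegenbauer_eq_sum hb hab, Finset.sum_mul, mul_assoc]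
  simp_rw [pow_zero, one_mul, ← pow_add]
  rw [integral_finsetSum _ fun k _ => integrable_finsetSum _ fun p _ => (hI _ _).const_mul _]
  refine Finset.sum_congr rfl fun k _ => ?_
  rw [integral_finsetSum _ fun p _ => (hI _ _).const_mul _]
  refine Finset.sum_congr rfl fun p _ => ?_
  have h3 := ellipseMoment_one ha hb hα p.1 (p.2 + m)
  rw [ellipseMoment] at h3
  simp only [one_mul] at h3
  rw [integral_const_mul, h3]
  push_cast
  ring

/-- The argument is `(r² + r⁻²) / 2` with `r = (a + b) / c`, so the trigonometric form applies and shows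
that the value is a sum of positive terms. -/
lemma gegenbauer_eval_eq_sum (hb : 0 < b) (hab : b < a) (lam : ℝ) (n : ℕ) :
    (gegenbauer lam n).eval ((a ^ 2 + b ^ 2) / (a ^ 2 - b ^ 2)) = ∑ p ∈ antidiagonal n,
      (ascPochhammer ℝ p.1).eval lam * (ascPochhammer ℝ p.2).eval lam /
        (p.1.factorial * p.2.factorial) *
      ((((a + b) / √(a ^ 2 - b ^ 2)) ^ 2) ^ p.1 *
        ((((a + b) / √(a ^ 2 - b ^ 2)) ^ 2)⁻¹) ^ p.2) := by
  have ha : 0 < a := hb.trans hab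
  have hsq : 0 < a ^ 2 - b ^ 2 := by nlinarith
  have hr : 0 < (a + b) / √(a ^ 2 - b ^ 2) := div_pos (by positivity) (Real.sqrt_pos.2 hsq)
  have h := aeval_gegenbauer_of_mul_eq_one (A := ℝ) lam n
    (x := (a ^ 2 + b ^ 2) / (a ^ 2 - b ^ 2)) (v := ((a + b) / √(a ^ 2 - b ^ 2)) ^ 2)
    (w := (((a + b) / √(a ^ 2 - b ^ 2)) ^ 2)⁻¹) (by
      rw [div_pow, Real.sq_sqrt hsq.le]
      have : a + b ≠ 0 := by positivity
      field_simp
      ring) (mul_inv_cancel₀ (by positivity))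
  simpa only [coe_aeval_eq_eval, smul_eq_mul] using h

lemma gegenbauer_eval_pos (hb : 0 < b) (hab : b < a) {lam : ℝ} (hlam : 0 < lam) (n : ℕ) :
    0 < (gegenbauer lam n).eval ((a ^ 2 + b ^ 2) / (a ^ 2 - b ^ 2)) := by
  have ha : 0 < a := hb.trans hab
  have hsq : 0 < a ^ 2 - b ^ 2 := by nlinarith
  have hr : 0 < (a + b) / √(a ^ 2 - b ^ 2) := div_pos (by positivity) (Real.sqrt_pos.2 hsq)
  rw [gegenbauer_eval_eq_sum hb hab]
  refine Finset.sum_pos (fun p _ => ?_) ⟨(0, n), by simp⟩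
  have h1 := ascPochhammer_pos p.1 lam hlam
  have h2 := ascPochhammer_pos p.2 lam hlam
  positivity

/-- If the antiholomorphic moments of degree less than `n` vanish, then pairing with the `n`-th Gegenbauer
polynomial sees only its leading part, hence amounts to the moment against `conj u ^ n`, with a
positive factor. -/
lemma integral_mul_conj_ellipseGegenbauer (hb : 0 < b) (hab : b < a) (hα : -1 < α)
    (hf : DifferentiableOn ℂ f (ellipse a b)) (hfi : Integrable f (ellipseMeasure a b α)) {n : ℕ}
    (h0 : ∀ k < n, ellipseMoment a b α f 0 k = 0) :
    ∫ z, f z * conj (ellipseGegenbauer a b (1 + α) n z) ∂ellipseMeasure a b α =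
      ((((a + b) / √(a ^ 2 - b ^ 2))⁻¹ ^ n *
        (gegenbauer (1 + α) n).eval ((a ^ 2 + b ^ 2) / (a ^ 2 - b ^ 2)) : ℝ) : ℂ) *
      ellipseMoment a b α f 0 n := by
  have ha : 0 < a := hb.trans hab
  have hlam : 0 < 1 + α := by linarith
  have hsq : 0 < a ^ 2 - b ^ 2 := by nlinarith
  have hr : 0 < (a + b) / √(a ^ 2 - b ^ 2) := div_pos (by positivity) (Real.sqrt_pos.2 hsq)
  have hm := moment_of_recurrence hlam hr (ellipseMoment_recurrence hb hab hα hf hfi) h0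
  rw [gegenbauer_eval_eq_sum hb hab]
  simp_rw [ellipseGegenbauer_eq_sum hb hab]
  set r := (a + b) / √(a ^ 2 - b ^ 2)
  have hI := integrable_mul_monomial ha hb hfi
  have hterm (c : ℝ) (i j : ℕ) (z : ℂ) : f z * conj ((c : ℂ) *
      (ellipseCoord a b z ^ i * conj (ellipseCoord a b z) ^ j)) =
      c * (f z * (ellipseCoord a b z ^ j * conj (ellipseCoord a b z) ^ i)) := by
    simp only [map_mul, map_pow, Complex.conj_conj, Complex.conj_ofReal]; ring
  simp_rw [map_sum, Finset.mul_sum, hterm]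
  rw [integral_finsetSum _ fun k _ => integrable_finsetSum _ fun p _ => (hI _ _).const_mul _]
  have hsum (k : ℕ) (c : ℕ × ℕ → ℝ) : ∫ z, ∑ p ∈ antidiagonal (n - 2 * k), (c p : ℂ) *
      (f z * (ellipseCoord a b z ^ p.2 * conj (ellipseCoord a b z) ^ p.1)) ∂ellipseMeasure a b α =
      ∑ p ∈ antidiagonal (n - 2 * k), (c p : ℂ) * ellipseMoment a b α f p.2 p.1 := by
    rw [integral_finsetSum _ fun p _ => (hI _ _).const_mul _]
    simp_rw [integral_const_mul]; rfl
  simp_rw [hsum]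
  rw [Finset.sum_eq_single 0]
  · rw [Complex.ofReal_sum, Finset.sum_mul]
    refine Finset.sum_congr rfl fun p hp => ?_
    rw [Finset.HasAntidiagonal.mem_antidiagonal] at hp
    rw [(hm p.2 p.1).2 (by omega), ← mul_assoc, ← Complex.ofReal_mul]
    congr 2
    rw [← hp]
    have := (ascPochhammer_pos (p.1 + p.2) (1 + α) hlam).ne'
    simp only [Nat.sub_zero, pow_zero, Nat.factorial_zero, Nat.cast_one, one_mul, inv_pow, pow_add,
      pow_mul]
    field_simp
    rw [← pow_mul, mul_comm p.1 2, pow_mul]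
    ring
  · intro k hk hk0
    rw [Finset.mem_range] at hk
    refine Finset.sum_eq_zero fun p hp => ?_
    rw [Finset.HasAntidiagonal.mem_antidiagonal] at hp
    rw [(hm p.2 p.1).1 (by omega), mul_zero]
  · simp

lemma gegenbauerNormSq_pos (hb : 0 < b) (hab : b < a) (hα : -1 < α) (n : ℕ) :
    0 < gegenbauerNormSq a b α n := by
  have h1 : 0 < 1 + α := by linarith
  have := gegenbauer_eval_pos hb hab h1 n
  unfold gegenbauerNormSq
  positivity

lemma integral_ellipseGegenbauer_mul_conj (hb : 0 < b) (hab : b < a) (hα : -1 < α) (m n : ℕ) :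
    ∫ z, ellipseGegenbauer a b (1 + α) n z * conj (ellipseGegenbauer a b (1 + α) m z)
      ∂ellipseMeasure a b α = if m = n then (gegenbauerNormSq a b α n : ℂ) else 0 := by
  have ha : 0 < a := hb.trans hab
  have hsq : 0 < a ^ 2 - b ^ 2 := by nlinarith
  have hr : 0 < (a + b) / √(a ^ 2 - b ^ 2) := div_pos (by positivity) (Real.sqrt_pos.2 hsq)
  have hle {m n : ℕ} (hmn : m ≤ n) : ∫ z, ellipseGegenbauer a b (1 + α) n z *
      conj (ellipseGegenbauer a b (1 + α) m z) ∂ellipseMeasure a b α =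
      if m = n then (gegenbauerNormSq a b α n : ℂ) else 0 := by
    have hd := differentiable_ellipseGegenbauer (a := a) (b := b) (1 + α) n
    rw [integral_mul_conj_ellipseGegenbauer hb hab hα hd.differentiableOn
      (integrable_of_continuous ha hb hα hd.continuous) fun k hk => by
        rw [ellipseMoment_ellipseGegenbauer hb hab hα (by omega), if_neg (by omega)],
      ellipseMoment_ellipseGegenbauer hb hab hα hmn]
    split_ifs with h
    · subst h
      rw [← Complex.ofReal_mul, gegenbauerNormSq]
      congr 1
      rw [inv_pow]
      field_simp
    · rw [mul_zero]
  rcases le_total m n with h | h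
  · exact hle h
  · have h1 := congrArg conj (hle h)
    rw [← integral_conj] at h1
    simp only [map_mul, Complex.conj_conj] at h1
    simp_rw [mul_comm (conj _)] at h1
    rw [h1]
    by_cases hmn : m = n
    · subst hmn; simp
    · simp [hmn, Ne.symm hmn]

end

/-! ### Determination of a function by its moments -/

section
variable {a b α : ℝ}
open Filter Topology
open scoped ComplexConjugate ContDiff
variable {f : ℂ → ℂ}

lemma eq_ellipseCoord_add (ha : 0 < a) (hb : 0 < b) (z : ℂ) :
    z = (((a + b) / 2 : ℝ) : ℂ) * ellipseCoord a b z +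
      (((a - b) / 2 : ℝ) : ℂ) * conj (ellipseCoord a b z) := by
  apply Complex.ext
  · simp [-Complex.ofReal_div]; field_simp; ring
  · simp [-Complex.ofReal_div]; field_simp; ring

/-- Extension by zero of a continuous function on the closed ellipse. -/
noncomputable def extendClosedEllipse {a b : ℝ} (g : C({z | ellipseForm a b z ≤ 1}, ℂ)) : ℂ → ℂ :=
  Function.extend Subtype.val g 0

lemma extendClosedEllipse_apply (g : C({z | ellipseForm a b z ≤ 1}, ℂ)) {z : ℂ}
    (hz : ellipseForm a b z ≤ 1) : extendClosedEllipse g z = g ⟨z, hz⟩ :=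
  Subtype.val_injective.extend_apply g 0 (⟨z, hz⟩ : {z | ellipseForm a b z ≤ 1})

lemma measurable_extendClosedEllipse (g : C({z | ellipseForm a b z ≤ 1}, ℂ)) :
    Measurable (extendClosedEllipse g) :=
  (MeasurableEmbedding.subtype_coe
    (isClosed_le continuous_ellipseForm continuous_const).measurableSet).measurable_extend
    g.continuous.measurable measurable_const

lemma integrable_mul_extendClosedEllipse [CompactSpace {z | ellipseForm a b z ≤ 1}]
    (hfi : Integrable f (ellipseMeasure a b α)) (g : C({z | ellipseForm a b z ≤ 1}, ℂ)) :
    Integrable (fun z => f z * extendClosedEllipse g z) (ellipseMeasure a b α) := by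
  refine hfi.mul_bdd (c := ‖g‖) (measurable_extendClosedEllipse g).aestronglyMeasurable
    (ae_mem_ellipse.mono fun z hz => ?_)
  rw [extendClosedEllipse_apply g (le_of_lt hz)]
  exact g.norm_coe_le_norm _

lemma continuous_integral_mul_extendClosedEllipse [CompactSpace {z | ellipseForm a b z ≤ 1}]
    (hfi : Integrable f (ellipseMeasure a b α)) :
    Continuous fun g : C({z | ellipseForm a b z ≤ 1}, ℂ) =>
      ∫ z, f z * extendClosedEllipse g z ∂ellipseMeasure a b α := by
  refine (LipschitzWith.of_dist_le_mul (K := (∫ z, ‖f z‖ ∂ellipseMeasure a b α).toNNReal)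
    fun g g' => ?_).continuous
  rw [dist_eq_norm, dist_eq_norm, ← integral_sub (integrable_mul_extendClosedEllipse hfi _)
    (integrable_mul_extendClosedEllipse hfi _), Real.coe_toNNReal _
    (integral_nonneg fun _ => norm_nonneg _), ← integral_mul_const]
  refine norm_integral_le_of_norm_le (hfi.norm.mul_const _) (ae_mem_ellipse.mono fun z hz => ?_)
  rw [extendClosedEllipse_apply g (le_of_lt hz), extendClosedEllipse_apply g' (le_of_lt hz),
    ← mul_sub, norm_mul]
  exact mul_le_mul_of_nonneg_left ((g - g').norm_coe_le_norm _) (norm_nonneg _)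

lemma ellipseMoment_congr {f g : ℂ → ℂ} (h : ∀ z ∈ ellipse a b, f z = g z) (i j : ℕ) :
    ellipseMoment a b α f i j = ellipseMoment a b α g i j :=
  integral_congr_ae (ae_mem_ellipse.mono fun z hz => by simp only [h z hz])

/-- Functions with vanishing moments are stable under multiplication by `z` and `conj z`, hence, by the
Stone–Weierstrass theorem, by every continuous function on the closed ellipse. -/
lemma ellipseMoment_mul_extendClosedEllipse (ha : 0 < a) (hb : 0 < b)
    [CompactSpace {z | ellipseForm a b z ≤ 1}] (g : C({z | ellipseForm a b z ≤ 1}, ℂ))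
    (hfi : Integrable f (ellipseMeasure a b α)) (h : ∀ i j, ellipseMoment a b α f i j = 0)
    (i j : ℕ) : ellipseMoment a b α (fun z => f z * extendClosedEllipse g z) i j = 0 := by
  have hlin (f : ℂ → ℂ) (hfi : Integrable f (ellipseMeasure a b α))
      (h : ∀ i j, ellipseMoment a b α f i j = 0) (p q : ℂ) (i j : ℕ) :
      ellipseMoment a b α (fun z => f z *
        (p * ellipseCoord a b z + q * conj (ellipseCoord a b z))) i j = 0 := by
    have hI := integrable_mul_monomial ha hb hfi
    have : ellipseMoment a b α (fun z => f z *
        (p * ellipseCoord a b z + q * conj (ellipseCoord a b z))) i j =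
        p * ellipseMoment a b α f (i + 1) j + q * ellipseMoment a b α f i (j + 1) := by
      unfold ellipseMoment
      rw [← integral_const_mul, ← integral_const_mul,
        ← integral_add ((hI _ _).const_mul _) ((hI _ _).const_mul _)]
      congr 1 with z
      ring
    rw [this, h, h]; ring
  induction g using ContinuousMap.induction_on_of_compact generalizing f i j with
  | const r =>
    rw [ellipseMoment_congr (g := fun z => f z * r)
      fun z hz => by rw [extendClosedEllipse_apply _ (le_of_lt hz)]; rfl]
    have := congrArg (r * ·) (h i j)
    simp only [ellipseMoment, ← integral_const_mul, mul_zero] at this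
    rw [ellipseMoment, ← this]
    congr 1 with z; ring
  | id =>
    rw [ellipseMoment_congr fun z hz => ?_]
    · exact hlin f hfi h (((a + b) / 2 : ℝ) : ℂ) (((a - b) / 2 : ℝ) : ℂ) i j
    · rw [extendClosedEllipse_apply _ (le_of_lt hz), ← eq_ellipseCoord_add ha hb z]; rfl
  | star_id =>
    rw [ellipseMoment_congr fun z hz => ?_]
    · exact hlin f hfi h (((a - b) / 2 : ℝ) : ℂ) (((a + b) / 2 : ℝ) : ℂ) i j
    · rw [extendClosedEllipse_apply _ (le_of_lt hz)]
      have := congrArg conj (eq_ellipseCoord_add ha hb z)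
      simp only [map_add, map_mul, Complex.conj_ofReal, Complex.conj_conj] at this
      rw [add_comm, ← this]; rfl
  | add g₁ g₂ h₁ h₂ =>
    have hI (g) := integrable_mul_monomial ha hb (integrable_mul_extendClosedEllipse hfi g) i j
    have := congrArg₂ (· + ·) (h₁ hfi h i j) (h₂ hfi h i j)
    simp only [ellipseMoment, ← integral_add (hI g₁) (hI g₂), add_zero] at this
    rw [ellipseMoment, ← this]
    refine integral_congr_ae (ae_mem_ellipse.mono fun z hz => ?_)
    simp only [extendClosedEllipse_apply _ (le_of_lt hz), ContinuousMap.add_apply]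
    ring
  | mul g₁ g₂ h₁ h₂ =>
    rw [← h₂ (integrable_mul_extendClosedEllipse hfi g₁) (h₁ hfi h) i j]
    refine ellipseMoment_congr (fun z hz => ?_) i j
    simp only [extendClosedEllipse_apply _ (le_of_lt hz), ContinuousMap.mul_apply]
    ring
  | frequently g hg =>
    have hc : IsClosed {g : C({z | ellipseForm a b z ≤ 1}, ℂ) |
        ellipseMoment a b α (fun z => f z * extendClosedEllipse g z) i j = 0} := by
      refine isClosed_eq ?_ continuous_const
      have := continuous_integral_mul_extendClosedEllipse (integrable_mul_monomial ha hb hfi i j)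
      simpa only [ellipseMoment, mul_right_comm] using this
    exact hc.closure_subset (mem_closure_iff_frequently.2 (hg.mono fun g' hg' => hg' hfi h i j))

/-- Integrable functions, holomorphic or not, are determined by their moments. -/
lemma ae_eq_zero_of_ellipseMoment_eq_zero (ha : 0 < a) (hb : 0 < b) (hα : -1 < α)
    (hfi : Integrable f (ellipseMeasure a b α)) (h : ∀ i j, ellipseMoment a b α f i j = 0) :
    f =ᵐ[ellipseMeasure a b α] 0 := by
  have : CompactSpace {z | ellipseForm a b z ≤ 1} :=
    isCompact_iff_compactSpace.1 (isCompact_closedEllipse ha hb 1)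
  have hint := (integrable_ellipseMeasure ha hb hα f).1 hfi
  rw [← integrable_indicator_iff measurableSet_ellipse] at hint
  have h0 := ae_eq_zero_of_integral_contDiff_smul_eq_zero hint.locallyIntegrable fun g hg _ => by
    have h1 := ellipseMoment_mul_extendClosedEllipse ha hb
      ⟨fun z : {z | ellipseForm a b z ≤ 1} => (g z : ℂ), by
        have := hg.continuous; fun_prop⟩ hfi h 0 0
    rw [ellipseMoment, integral_ellipseMeasure ha hb hα, ← integral_indicator measurableSet_ellipse]
      at h1
    rw [← h1]
    congr 1 with z
    by_cases hz : z ∈ ellipse a b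
    · simp only [Set.indicator_of_mem hz, extendClosedEllipse_apply _ (le_of_lt hz),
        ContinuousMap.coe_mk, pow_zero, mul_one, Complex.real_smul]
      ring
    · simp only [Set.indicator_of_notMem hz, smul_zero]
  rw [EventuallyEq, ae_ellipseMeasure_iff ha hb hα]
  filter_upwards [ae_restrict_of_ae h0, ae_restrict_mem measurableSet_ellipse] with z hz hzE
  rw [Set.indicator_of_mem hzE] at hz
  exact (mul_eq_zero.1 hz).resolve_left
    (Complex.ofReal_ne_zero.2 (ellipseWeight_pos ha hb hα hzE).ne')

end

/-! ### Area mean value inequality and closedness of the Bergman space -/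

section
variable {a b α : ℝ}
open Filter Topology
variable {f : ℂ → ℂ}

lemma two_pi_mul_enorm_le_lintegral_circle {c : ℂ} {R r : ℝ}
    (hf : DifferentiableOn ℂ f (Metric.ball c R)) (hr : 0 < r) (hrR : r < R) :
    ENNReal.ofReal (2 * Real.pi) * ‖f c‖ₑ ≤
      ∫⁻ θ in Set.Ioo (-Real.pi) Real.pi, ‖f (circleMap c r θ)‖ₑ := by
  have hd : DiffContOnCl ℂ f (Metric.ball c |r|) := by
    rw [abs_of_pos hr]
    exact (hf.mono (Metric.closure_ball_subset_closedBall.trans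
      (Metric.closedBall_subset_ball hrR))).diffContOnCl
  have h := hd.circleAverage
  rw [Real.circleAverage_eq_integral_add (-Real.pi),
    intervalIntegral.integral_comp_add_right (fun θ => f (circleMap c r θ)),
    zero_add, show 2 * Real.pi + -Real.pi = Real.pi by ring,
    intervalIntegral.integral_of_le (by linarith [Real.pi_pos]), integral_Ioc_eq_integral_Ioo,
    inv_smul_eq_iff₀ (by positivity)] at h
  calc _ = ‖(2 * Real.pi) • f c‖ₑ := by
        rw [enorm_smul, Real.enorm_of_nonneg (by positivity)]
    _ ≤ _ := by rw [← h]; exact enorm_integral_le_lintegral_enorm _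

/-- An area form of the mean value inequality. The circles of radius between `R / 2` and `R` suffice for
some positive constant, and this one is not sharp. -/
lemma enorm_le_lintegral_ball {c : ℂ} {R : ℝ} (hR : 0 < R)
    (hf : DifferentiableOn ℂ f (Metric.ball c R)) :
    ENNReal.ofReal (Real.pi * R ^ 2 / 2) * ‖f c‖ₑ ≤ ∫⁻ z in Metric.ball c R, ‖f z‖ₑ := by
  classical
  set g : ℂ → ℂ := (Metric.ball c R).piecewise f 0
  have hg : Measurable g := hf.continuousOn.measurable_piecewise continuousOn_const
    Metric.isOpen_ball.measurableSet
  have hgf : ∀ z ∈ Metric.ball c R, g z = f z := fun z hz => Set.piecewise_eq_of_mem _ _ _ hz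
  have h1 : ∫⁻ z in Metric.ball c R, ‖f z‖ₑ = ∫⁻ z, ‖g (c + z)‖ₑ := by
    rw [lintegral_add_left_eq_self (fun z => ‖g z‖ₑ) c,
      ← lintegral_indicator Metric.isOpen_ball.measurableSet]
    congr 1 with z
    by_cases hz : z ∈ Metric.ball c R
    · rw [Set.indicator_of_mem hz, hgf z hz]
    · rw [Set.indicator_of_notMem hz, show g z = 0 from Set.piecewise_eq_of_notMem _ _ _ hz,
        enorm_zero]
  have hpm : Measurable fun p : ℝ × ℝ =>
      ENNReal.ofReal p.1 • ‖g (c + Complex.polarCoord.symm p)‖ₑ := by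
    simp only [Complex.polarCoord_symm_apply]
    fun_prop
  rw [h1, ← Complex.lintegral_comp_polarCoord_symm, polarCoord_target, Measure.volume_eq_prod,
    ← Measure.prod_restrict, lintegral_prod _ hpm.aemeasurable]
  calc ENNReal.ofReal (Real.pi * R ^ 2 / 2) * ‖f c‖ₑ
      = ∫⁻ _ in Set.Ioo (R / 2) R, ENNReal.ofReal (R / 2) *
          (ENNReal.ofReal (2 * Real.pi) * ‖f c‖ₑ) := by
        rw [setLIntegral_const, Real.volume_Ioo, mul_right_comm, ← mul_assoc,
          ← ENNReal.ofReal_mul (by positivity), mul_right_comm,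
          mul_right_comm, ← ENNReal.ofReal_mul (by nlinarith)]
        congr 2
        ring
    _ ≤ ∫⁻ r in Set.Ioo (R / 2) R, ∫⁻ θ in Set.Ioo (-Real.pi) Real.pi,
          ENNReal.ofReal r • ‖g (c + Complex.polarCoord.symm (r, θ))‖ₑ := by
        refine setLIntegral_mono' measurableSet_Ioo fun r hr => ?_
        have hr0 : 0 < r := by linarith [hr.1]
        simp only [smul_eq_mul]
        rw [lintegral_const_mul _ (by simp only [Complex.polarCoord_symm_apply]; fun_prop)]
        refine mul_le_mul' (ENNReal.ofReal_le_ofReal hr.1.le) ?_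
        refine (two_pi_mul_enorm_le_lintegral_circle hf hr0 hr.2).trans (le_of_eq ?_)
        congr 1 with θ
        have : c + Complex.polarCoord.symm (r, θ) = circleMap c r θ := by
          rw [Complex.polarCoord_symm_apply, circleMap, Complex.exp_mul_I]; push_cast; rfl
        rw [this, hgf]
        rw [Metric.mem_ball, dist_eq_norm, circleMap_sub_center, norm_circleMap_zero,
          abs_of_pos hr0]
        exact hr.2
    _ ≤ _ := lintegral_mono_set fun r hr => by
        have : R / 2 < r := hr.1
        exact lt_trans (by positivity) this

lemma continuousOn_ellipseWeight :
    ContinuousOn (fun z => (1 + α) * (1 - ellipseForm a b z) ^ α / (Real.pi * a * b))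
      (ellipse a b) := by
  refine (ContinuousOn.mul continuousOn_const (ContinuousOn.rpow_const
    (continuous_const.sub continuous_ellipseForm).continuousOn fun z hz => ?_)).div_const _
  exact Or.inl (sub_pos.2 hz).ne'

/-- Point evaluations are bounded, uniformly on compact sets, because the weight is bounded below there. -/
lemma exists_enorm_le_lintegral_ellipseMeasure (ha : 0 < a) (hb : 0 < b) (hα : -1 < α) {K : Set ℂ}
    (hK : IsCompact K) (hKE : K ⊆ ellipse a b) :
    ∃ C : NNReal, ∀ f : ℂ → ℂ, DifferentiableOn ℂ f (ellipse a b) → ∀ z ∈ K,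
      ‖f z‖ₑ ≤ C * ∫⁻ w, ‖f w‖ₑ ∂ellipseMeasure a b α := by
  obtain ⟨δ, hδ, hδE⟩ := hK.exists_cthickening_subset_open isOpen_ellipse hKE
  obtain ⟨m, hm, hmw⟩ : ∃ m : ℝ, 0 < m ∧ ∀ z ∈ Metric.cthickening δ K,
      m ≤ (1 + α) * (1 - ellipseForm a b z) ^ α / (Real.pi * a * b) :=
    (hK.cthickening (r := δ)).exists_forall_le' (continuousOn_ellipseWeight.mono hδE)
      fun z hz => ellipseWeight_pos ha hb hα (hδE hz)
  have hD : 0 < m * (Real.pi * δ ^ 2 / 2) := by have := Real.pi_pos; positivity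
  refine ⟨(m * (Real.pi * δ ^ 2 / 2)).toNNReal⁻¹, fun f hf z hz => ?_⟩
  have hball : Metric.ball z δ ⊆ Metric.cthickening δ K :=
    (Metric.ball_subset_thickening hz δ).trans (Metric.thickening_subset_cthickening δ K)
  rw [ENNReal.coe_inv (Real.toNNReal_pos.2 hD).ne', ← ENNReal.div_eq_inv_mul,
    ENNReal.le_div_iff_mul_le (Or.inl (by simpa using hD)) (Or.inl ENNReal.coe_ne_top), mul_comm]
  change ENNReal.ofReal _ * _ ≤ _
  calc ENNReal.ofReal (m * (Real.pi * δ ^ 2 / 2)) * ‖f z‖ₑ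
      = ENNReal.ofReal m * (ENNReal.ofReal (Real.pi * δ ^ 2 / 2) * ‖f z‖ₑ) := by
        rw [ENNReal.ofReal_mul hm.le, mul_assoc]
    _ ≤ ENNReal.ofReal m * ∫⁻ w in Metric.ball z δ, ‖f w‖ₑ := by
        gcongr
        exact enorm_le_lintegral_ball hδ (hf.mono (hball.trans hδE))
    _ = ∫⁻ w in Metric.ball z δ, ENNReal.ofReal m * ‖f w‖ₑ :=
        (lintegral_const_mul' _ _ ENNReal.ofReal_ne_top).symm
    _ ≤ ∫⁻ w in Metric.ball z δ, ENNReal.ofReal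
          ((1 + α) * (1 - ellipseForm a b w) ^ α / (Real.pi * a * b)) * ‖f w‖ₑ := by
        refine setLIntegral_mono' Metric.isOpen_ball.measurableSet fun w hw => ?_
        gcongr
        exact hmw w (hball hw)
    _ ≤ ∫⁻ w in ellipse a b, ENNReal.ofReal
          ((1 + α) * (1 - ellipseForm a b w) ^ α / (Real.pi * a * b)) * ‖f w‖ₑ :=
        lintegral_mono_set (hball.trans hδE)
    _ = ∫⁻ w, ‖f w‖ₑ ∂ellipseMeasure a b α := by
        rw [ellipseMeasure, lintegral_withDensity_eq_lintegral_mul₀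
          measurable_ellipseWeight.aemeasurable
          (hf.continuousOn.aestronglyMeasurable measurableSet_ellipse).enorm]
        rfl

lemma exists_norm_le_mul_norm (ha : 0 < a) (hb : 0 < b) (hα : -1 < α) {K : Set ℂ}
    (hK : IsCompact K) (hKE : K ⊆ ellipse a b) :
    ∃ C : NNReal, ∀ (F : Lp ℂ 2 (ellipseMeasure a b α)) (f : ℂ → ℂ),
      DifferentiableOn ℂ f (ellipse a b) → (F : ℂ → ℂ) =ᵐ[ellipseMeasure a b α] f →
      ∀ z ∈ K, ‖f z‖ ≤ C * ‖F‖ := by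
  have := isProbabilityMeasure_ellipseMeasure ha hb hα
  obtain ⟨C, hC⟩ := exists_enorm_le_lintegral_ellipseMeasure ha hb hα hK hKE
  refine ⟨C, fun F f hf hFf z hz => ?_⟩
  have h1 : ∫⁻ w, ‖f w‖ₑ ∂ellipseMeasure a b α ≤ ‖F‖ₑ := by
    rw [← eLpNorm_one_eq_lintegral_enorm, ← eLpNorm_congr_ae hFf, Lp.enorm_def]
    exact eLpNorm_le_eLpNorm_of_exponent_le one_le_two (Lp.aestronglyMeasurable F)
  have h2 := (hC f hf z hz).trans (mul_le_mul_right h1 _)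
  rw [← ofReal_norm, ← ofReal_norm, ← ENNReal.ofReal_coe_nnreal,
    ← ENNReal.ofReal_mul C.coe_nonneg] at h2
  exact (ENNReal.ofReal_le_ofReal_iff (by positivity)).1 h2

/-- Convergence in `L²` implies locally uniform convergence of the holomorphic representatives. -/
lemma isClosed_bergmanSpace (ha : 0 < a) (hb : 0 < b) (hα : -1 < α) :
    IsClosed (bergmanSpace a b α : Set (Lp ℂ 2 (ellipseMeasure a b α))) := by
  refine IsSeqClosed.isClosed fun F F₀ hF hlim => ?_
  choose g hgd hgF using hF
  have hcauchy (K : Set ℂ) (hK : IsCompact K) (hKE : K ⊆ ellipse a b) :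
      UniformCauchySeqOn g atTop K := by
    obtain ⟨C, hC⟩ := exists_norm_le_mul_norm ha hb hα hK hKE
    rw [Metric.uniformCauchySeqOn_iff]
    intro ε hε
    obtain ⟨N, hN⟩ := Metric.cauchySeq_iff.1 hlim.cauchySeq (ε / (C + 1)) (by positivity)
    refine ⟨N, fun m hm n hn z hz => ?_⟩
    have h1 := hN m hm n hn
    rw [dist_eq_norm] at h1 ⊢
    have h2 := hC (F m - F n) (g m - g n) ((hgd m).sub (hgd n))
      ((Lp.coeFn_sub _ _).trans ((hgF m).sub (hgF n))) z hz
    rw [lt_div_iff₀ (by positivity)] at h1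
    calc ‖g m z - g n z‖ ≤ C * ‖F m - F n‖ := h2
      _ ≤ ‖F m - F n‖ * (C + 1) := by nlinarith [norm_nonneg (F m - F n)]
      _ < ε := h1
  have hpt : ∀ z ∈ ellipse a b, ∃ w, Tendsto (fun n => g n z) atTop (𝓝 w) := fun z hz =>
    cauchySeq_tendsto_of_complete ((hcauchy {z} isCompact_singleton
      (Set.singleton_subset_iff.2 hz)).cauchySeq (Set.mem_singleton z))
  choose! g₀ hg₀ using hpt
  have hloc : TendstoLocallyUniformlyOn g g₀ atTop (ellipse a b) := by
    rw [tendstoLocallyUniformlyOn_iff_forall_isCompact isOpen_ellipse]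
    exact fun K hKE hK => (hcauchy K hK hKE).tendstoUniformlyOn_of_tendsto
      fun z hz => hg₀ z (hKE hz)
  refine ⟨g₀, hloc.differentiableOn (Eventually.of_forall hgd) isOpen_ellipse, ?_⟩
  obtain ⟨φ, hφ, hφlim⟩ := (tendstoInMeasure_of_tendsto_Lp hlim).exists_seq_tendsto_ae
  filter_upwards [hφlim, ae_all_iff.2 hgF, ae_mem_ellipse] with z h1 h2 h3
  refine tendsto_nhds_unique h1 ?_
  simp_rw [h2]
  exact (hg₀ z h3).comp hφ.tendsto_atTop

end

/-! ### The orthonormal basis -/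

section
variable {a b α : ℝ}
open scoped ComplexConjugate

lemma normalizedGegenbauer_eq (n : ℕ) (z : ℂ) : normalizedGegenbauer a b α n z =
    ellipseGegenbauer a b (1 + α) n z / (√(gegenbauerNormSq a b α n) : ℂ) := rfl

lemma differentiable_normalizedGegenbauer (n : ℕ) :
    Differentiable ℂ (normalizedGegenbauer a b α n) :=
  (differentiable_ellipseGegenbauer (1 + α) n).div_const _

lemma memLp_normalizedGegenbauer (ha : 0 < a) (hb : 0 < b) (hα : -1 < α) (n : ℕ) :
    MemLp (normalizedGegenbauer a b α n) 2 (ellipseMeasure a b α) := by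
  have := isProbabilityMeasure_ellipseMeasure ha hb hα
  have hc := (differentiable_normalizedGegenbauer (a := a) (b := b) (α := α) n).continuous
  obtain ⟨C, hC⟩ := exists_norm_le_of_continuous ha hb hc
  exact MemLp.of_bound hc.aestronglyMeasurable C (ae_mem_ellipse.mono hC)

/-- The normalized Gegenbauer polynomial as an element of the Bergman space. -/
noncomputable def bergmanGegenbauer (ha : 0 < a) (hb : 0 < b) (hα : -1 < α) (n : ℕ) :
    bergmanSpace a b α :=
  ⟨(memLp_normalizedGegenbauer ha hb hα n).toLp _, normalizedGegenbauer a b α n,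
    (differentiable_normalizedGegenbauer n).differentiableOn, MemLp.coeFn_toLp _⟩

lemma coeFn_bergmanGegenbauer (ha : 0 < a) (hb : 0 < b) (hα : -1 < α) (n : ℕ) :
    ((bergmanGegenbauer ha hb hα n : Lp ℂ 2 (ellipseMeasure a b α)) : ℂ → ℂ)
      =ᵐ[ellipseMeasure a b α] normalizedGegenbauer a b α n :=
  (memLp_normalizedGegenbauer ha hb hα n).coeFn_toLp

lemma inner_bergmanGegenbauer (ha : 0 < a) (hb : 0 < b) (hα : -1 < α) (n : ℕ)
    {F : bergmanSpace a b α} {f : ℂ → ℂ}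
    (hF : ((F : Lp ℂ 2 (ellipseMeasure a b α)) : ℂ → ℂ) =ᵐ[ellipseMeasure a b α] f) :
    inner ℂ (bergmanGegenbauer ha hb hα n) F =
      (∫ z, f z * conj (ellipseGegenbauer a b (1 + α) n z) ∂ellipseMeasure a b α) /
        (√(gegenbauerNormSq a b α n) : ℂ) := by
  rw [Submodule.coe_inner, L2.inner_def, ← integral_div]
  refine integral_congr_ae ?_
  filter_upwards [hF, coeFn_bergmanGegenbauer ha hb hα n] with z h1 h2
  rw [h1, h2, RCLike.inner_apply, normalizedGegenbauer_eq, map_div₀, Complex.conj_ofReal,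
    mul_div_assoc]

lemma orthonormal_bergmanGegenbauer (hb : 0 < b) (hab : b < a) (hα : -1 < α) :
    Orthonormal ℂ (bergmanGegenbauer (hb.trans hab) hb hα) := by
  rw [orthonormal_iff_ite]
  intro m n
  have h1 (z : ℂ) : normalizedGegenbauer a b α n z *
      conj (ellipseGegenbauer a b (1 + α) m z) = ellipseGegenbauer a b (1 + α) n z *
      conj (ellipseGegenbauer a b (1 + α) m z) / (√(gegenbauerNormSq a b α n) : ℂ) := by
    rw [normalizedGegenbauer_eq, div_mul_eq_mul_div]
  rw [inner_bergmanGegenbauer _ hb hα m (coeFn_bergmanGegenbauer _ hb hα n)]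
  simp_rw [h1]
  rw [integral_div, integral_ellipseGegenbauer_mul_conj hb hab hα]
  split_ifs with h
  · subst h
    have hpos := gegenbauerNormSq_pos hb hab hα m
    have hs : ((√(gegenbauerNormSq a b α m) : ℝ) : ℂ) ≠ 0 := by
      exact_mod_cast (Real.sqrt_pos.2 hpos).ne'
    rw [div_div, ← Complex.ofReal_mul, Real.mul_self_sqrt hpos.le, div_self]
    exact_mod_cast hpos.ne'
  · simp

/-- Completeness of the Gegenbauer polynomials: orthogonality to all of them forces the antiholomorphic
moments to vanish one after the other, hence all moments. -/
lemma eq_zero_of_inner_bergmanGegenbauer_eq_zero (hb : 0 < b) (hab : b < a) (hα : -1 < α)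
    (F : bergmanSpace a b α)
    (h : ∀ n, inner ℂ (bergmanGegenbauer (hb.trans hab) hb hα n) F = 0) : F = 0 := by
  have ha : 0 < a := hb.trans hab
  have := isProbabilityMeasure_ellipseMeasure ha hb hα
  obtain ⟨f, hfd, hFf⟩ := F.2
  have hfi : Integrable f (ellipseMeasure a b α) :=
    ((Lp.memLp (F : Lp ℂ 2 (ellipseMeasure a b α))).integrable one_le_two).congr hFf
  have hlam : 0 < 1 + α := by linarith
  have hsq : 0 < a ^ 2 - b ^ 2 := by nlinarith
  have hr : 0 < (a + b) / √(a ^ 2 - b ^ 2) := div_pos (by positivity) (Real.sqrt_pos.2 hsq)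
  have h0 (n : ℕ) : ellipseMoment a b α f 0 n = 0 := by
    induction n using Nat.strong_induction_on with
    | _ n ih =>
      have h1 := h n
      have hs := (Real.sqrt_pos.2 (gegenbauerNormSq_pos hb hab hα n)).ne'
      rw [inner_bergmanGegenbauer ha hb hα n hFf, div_eq_zero_iff,
        or_iff_left (by exact_mod_cast hs),
        integral_mul_conj_ellipseGegenbauer hb hab hα hfd hfi ih] at h1
      refine (mul_eq_zero.1 h1).resolve_left (Complex.ofReal_ne_zero.2 ?_)
      have := gegenbauer_eval_pos hb hab hlam n
      positivity
  have hmom (i j : ℕ) : ellipseMoment a b α f i j = 0 :=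
    (moment_of_recurrence hlam hr (ellipseMoment_recurrence hb hab hα hfd hfi)
      (n := i + j + 1) (fun k _ => h0 k) i j).1 (Nat.lt_succ_self _)
  ext1
  exact (Lp.eq_zero_iff_ae_eq_zero).2
    (hFf.trans (ae_eq_zero_of_ellipseMoment_eq_zero ha hb hα hfi hmom))

end

theorem theorem3p1 (a b α : ℝ) (hb : 0 < b) (hab : b < a) (hα : -1 < α) :
    (∀ n : ℕ, 0 < gegenbauerNormSq a b α n) ∧
    ∃ B : HilbertBasis ℕ ℂ (bergmanSpace a b α), ∀ n : ℕ,
      ((B n : Lp ℂ 2 (ellipseMeasure a b α)) : ℂ → ℂ)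
        =ᵐ[ellipseMeasure a b α] normalizedGegenbauer a b α n := by
  refine ⟨gegenbauerNormSq_pos hb hab hα, ?_⟩
  have ha : 0 < a := hb.trans hab
  have : CompleteSpace (bergmanSpace a b α) :=
    (isClosed_bergmanSpace ha hb hα).completeSpace_coe
  refine ⟨HilbertBasis.mkOfOrthogonalEqBot (orthonormal_bergmanGegenbauer hb hab hα) ?_,
    fun n => ?_⟩
  · rw [Submodule.eq_bot_iff]
    intro F hF
    exact eq_zero_of_inner_bergmanGegenbauer_eq_zero hb hab hα F fun n =>
      (Submodule.mem_orthogonal _ _).1 hF _ (Submodule.subset_span (Set.mem_range_self n))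
  · rw [HilbertBasis.coe_mkOfOrthogonalEqBot]
    exact coeFn_bergmanGegenbauer ha hb hα n
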